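/- **Setting.** Let $V=\coprod_{n\in\mathbb Z}V_{(n)}$ be a vertex operator algebra over $\mathbb C$ (in the sense of Frenkel–Lepowsky–Meurman and Frenkel–Huang–Lepowsky), and put $V_+=\coprod_{n>0}V_{(n)}$. A *discretely $\mathbb R$-graded $V$-module* is a $V$-module $W=\coprod_{r\in\mathbb R}W_{(r)}$, graded by the real eigenvalues of $L(0)$, such that $\coprod_{s\le r}W_{(s)}$ is finite-dimensional for every $r\in\mathbb R$. Writing $Y(u,x)=\sum_{n\in\mathbb Z}u_nx^{-n-1}$ for the vertex operators on $W$, let $C_1(W)$ be the span of all $u_{-1}w$ with $u\in V_+$ and $w\in W$; $W$ is *$C_1$-cofinite* if $\dim W/C_1(W)<\infty$. Let $W'=\coprod_r (W_{(r)})^*$ denote the contragredient of $W$, with vertex operators given by $\langle Y'(u,x)w',w\rangle=\langle w',Y(e^{xL(1)}(-x^{-2})^{L(0)}u,x^{-1})w\rangle$. An *intertwining operator* $\mathcal Y$ of type $\binom{W_c}{W_aW_b}$ is a linear map $w\mapsto\mathcal Y(w,x)=\sum_{n\in\mathbb R}w_n x^{-n-1}$ from $W_a$ to series with coefficients in $\mathrm{Hom}(W_b,W_c)$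 such that, for all $w\in W_a$ and $w'\in W_b$, $w_nw'=0$ for $n$ sufficiently large, and such that the Jacobi identity and the $L(-1)$-derivative property $\mathcal Y(L(-1)w,x)=\frac{d}{dx}\mathcal Y(w,x)$ hold. Let $R=\mathbb C[z_1^{\pm1},z_2^{\pm1},(z_1-z_2)^{-1}]$. **Theorem.** Let $W_0,W_1,W_2,W_3$ be $C_1$-cofinite discretely $\mathbb R$-graded $V$-modules and let $w_i\in W_i$ for $i=0,1,2,3$. Then there exist positive integers $m,n$ and elements $a_1,\dots,a_m,b_1,\dots,b_n\in R$ such that for any discretely $\mathbb R$-graded $V$-modules $W_4,W_5,W_6$ and any intertwining operators $\mathcal Y_1,\dots,\mathcal Y_6$ of types $$\binom{W_0'}{W_1W_4},\quad\binom{W_4}{W_2W_3},\quad\binom{W_5}{W_1W_2},\quad\binom{W_0'}{W_5W_3},\quad\binom{W_0'}{W_2W_6},\quad\binom{W_6}{W_1W_3}$$ respectively, the series $$\langle w_0,\mathcal Y_1(w_1,z_1)\mathcal Y_2(w_2,z_2)w_3\rangle,\qquad \langle w_0,\mathcal Y_4(\mathcal Y_3(w_1,z_1-z_2)w_2,z_2)w_3\rangle,\qquad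 \langle w_0,\mathcal Y_5(w_2,z_2)\mathcal Y_6(w_1,z_1)w_3\rangle$$ satisfy the expansions, in the regions $|z_1|>|z_2|>0$, $|z_2|>|z_1-z_2|>0$ and $|z_2|>|z_1|>0$ respectively, of the system $$\frac{\partial^m\varphi}{\partial z_1^m}+a_1(z_1,z_2)\frac{\partial^{m-1}\varphi}{\partial z_1^{m-1}}+\cdots+a_m(z_1,z_2)\varphi=0,$$ $$\frac{\partial^n\varphi}{\partial z_2^n}+b_1(z_1,z_2)\frac{\partial^{n-1}\varphi}{\partial z_2^{n-1}}+\cdots+b_n(z_1,z_2)\varphi=0.$$ In particular $m$, $n$, the $a_k$ and the $b_l$ do not depend on $W_4,W_5,W_6$ or on $\mathcal Y_1,\dots,\mathcal Y_6$. Here the three expressions are regarded as formal series with real exponents, in the independent variables $(z_1,z_2)$, $(z_2,\,z_1-z_2)$ and $(z_2,z_1)$ respectively (so in the second case $\partial/\partial z_1$ and $\partial/\partial z_2$ are $\partial_{z_0}$ and $\partial_{z_2}-\partial_{z_0}$ with $z_0=z_1-z_2$). Elements of $R$ are expanded in the indicated region as series in integral powers of the same two variables. The assertion is that in each product of an expanded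 coefficient with a derivative of the series, every coefficient is a finite sum, and that both equations hold coefficient by coefficient. -/

import Mathlib

/-!
Vertex operators are handled through their modes: `Y(u, x) = ∑ u_n x^(-n-1)` is recorded as the
family `n ↦ (u ↦ (w ↦ u_n w))`.
-/

/-- A family of modes: `Y n u w` is `u_n w`, where `Y(u, x) w = ∑ n, u_n w x^(-n-1)`. -/
abbrev Modes (V W : Type*) [AddCommGroup V] [Module ℂ V] [AddCommGroup W] [Module ℂ W] :=
  ℤ → V →ₗ[ℂ] W →ₗ[ℂ] W

/-- The Jacobi identity
`x₀⁻¹ δ((x₁-x₂)/x₀) Y₃(u,x₁) 𝓨(w₁,x₂) w₂ - x₀⁻¹ δ((x₂-x₁)/(-x₀)) 𝓨(w₁,x₂) Y₂(u,x₁) w₂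
  = x₂⁻¹ δ((x₁-x₀)/x₂) 𝓨(Y₁(u,x₀) w₁, x₂) w₂`,
written out as the equality of the coefficients of `x₀^(-l-1) x₁^(-m-1) x₂^(-n-1)` on both sides.
Here `I n w₁ w₂` is the coefficient of `x₂^(-n-1)` in `𝓨(w₁,x₂) w₂`, and the modes are indexed by
a type `K` of exponents (`ℤ` for algebras and modules, `ℝ` for intertwining operators).  All three
sums are finite as soon as `Y₁`, `Y₂` and `I` are lower truncated, which is
required wherever this identity is used. -/
def JacobiIdentity {K V W₁ W₂ W₃ : Type*} [AddGroupWithOne K]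
    [AddCommGroup V] [Module ℂ V] [AddCommGroup W₁] [Module ℂ W₁]
    [AddCommGroup W₂] [Module ℂ W₂] [AddCommGroup W₃] [Module ℂ W₃]
    (Y₁ : Modes V W₁) (Y₂ : Modes V W₂) (Y₃ : Modes V W₃)
    (I : K → W₁ →ₗ[ℂ] W₂ →ₗ[ℂ] W₃) : Prop :=
  ∀ (u : V) (w₁ : W₁) (w₂ : W₂) (l m : ℤ) (n : K),
    (∑ᶠ i : ℕ, ((-1 : ℂ) ^ i * ((Ring.choose l i : ℤ) : ℂ)) •
        Y₃ (m + l - i) u (I (n + (i : K)) w₁ w₂))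
      - (∑ᶠ i : ℕ, ((-1 : ℂ) ^ ((i : ℤ) + l) * ((Ring.choose l i : ℤ) : ℂ)) •
        I (n + (l : K) - (i : K)) w₁ (Y₂ (m + i) u w₂))
    = ∑ᶠ i : ℕ, ((Ring.choose m i : ℤ) : ℂ) • I ((m : K) + n - (i : K)) (Y₁ (l + i) u w₁) w₂

/-- The relations of the Virasoro algebra with central charge `c`. -/
def VirasoroRelations {W : Type*} [AddCommGroup W] [Module ℂ W]
    (L : ℤ → W →ₗ[ℂ] W) (c : ℂ) : Prop :=
  ∀ (m n : ℤ) (w : W), L m (L n w) - L n (L m w)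
    = ((m : ℂ) - n) • L (m + n) w
      + (if m + n = 0 then ((m : ℂ) ^ 3 - m) / 12 * c else 0) • w

/-- A vertex operator algebra structure on the complex vector space `V`. -/
structure VertexOperatorAlgebra (V : Type*) [AddCommGroup V] [Module ℂ V] where
  /-- the homogeneous subspaces `V_(n)` -/
  grading : ℤ → Submodule ℂ V
  /-- the vertex operator map -/
  Y : Modes V V
  /-- the vacuum vector -/
  vac : V
  /-- the conformal vector -/
  omega : V
  /-- the central charge (rank) -/
  c : ℂ
  decomp : DirectSum.IsInternal grading
  finite_grading : ∀ n, FiniteDimensional ℂ (grading n)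
  grading_eq_bot : ∃ N : ℤ, ∀ n < N, grading n = ⊥
  vac_mem : vac ∈ grading 0
  omega_mem : omega ∈ grading 2
  truncation : ∀ u v, ∃ N : ℤ, ∀ n ≥ N, Y n u v = 0
  vacuum : ∀ (n : ℤ) (v : V), Y n vac v = if n = -1 then v else 0
  creation : ∀ u : V, Y (-1) u vac = u ∧ ∀ n : ℤ, 0 ≤ n → Y n u vac = 0
  jacobi : JacobiIdentity Y Y Y Y
  virasoro : VirasoroRelations (fun n => Y (n + 1) omega) c
  /-- `V_(n)` is the eigenspace of `L(0) = omega_1` with eigenvalue `n` -/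
  mem_grading_iff : ∀ (n : ℤ) (v : V), v ∈ grading n ↔ Y 1 omega v = (n : ℂ) • v
  /-- `Y(L(-1)u, x) = d/dx Y(u, x)`, with `L(-1) = omega_0` -/
  derivative : ∀ (n : ℤ) (u v : V), Y n (Y 0 omega u) v = (-(n : ℂ)) • Y (n - 1) u v

/-- A discretely `ℝ`-graded module structure on `W`: a `V`-module graded by the real eigenvalues
of `L(0)` such that, for every real `r`, the sum of the homogeneous subspaces of weight at most
`r` is finite-dimensional.  (In particular every homogeneous subspace is finite-dimensional and
the homogeneous subspaces of sufficiently negative weight vanish.) -/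
structure DiscreteModule {V : Type*} [AddCommGroup V] [Module ℂ V] (𝕍 : VertexOperatorAlgebra V)
    (W : Type*) [AddCommGroup W] [Module ℂ W] where
  /-- the homogeneous subspaces `W_(r)` -/
  grading : ℝ → Submodule ℂ W
  /-- the vertex operator map -/
  Y : Modes V W
  decomp : DirectSum.IsInternal grading
  discrete : ∀ r : ℝ, FiniteDimensional ℂ (⨆ s : Set.Iic r, grading s : Submodule ℂ W)
  truncation : ∀ u w, ∃ N : ℤ, ∀ n ≥ N, Y n u w = 0
  vacuum : ∀ (n : ℤ) (w : W), Y n 𝕍.vac w = if n = -1 then w else 0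
  jacobi : JacobiIdentity 𝕍.Y Y Y Y
  virasoro : VirasoroRelations (fun n => Y (n + 1) 𝕍.omega) 𝕍.c
  /-- `W_(r)` is the eigenspace of `L(0) = omega_1` with eigenvalue `r` -/
  mem_grading_iff : ∀ (r : ℝ) (w : W), w ∈ grading r ↔ Y 1 𝕍.omega w = (r : ℂ) • w
  /-- `Y(L(-1)u, x) = d/dx Y(u, x)` -/
  derivative : ∀ (n : ℤ) (u : V) (w : W),
    Y n (𝕍.Y 0 𝕍.omega u) w = (-(n : ℂ)) • Y (n - 1) u w

namespace VertexOperatorAlgebra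

variable {V : Type*} [AddCommGroup V] [Module ℂ V] (𝕍 : VertexOperatorAlgebra V)

/-- `V_+ = ∐_{n > 0} V_(n)`. -/
def positivePart : Submodule ℂ V := ⨆ n : Set.Ioi (0 : ℤ), 𝕍.grading n

/-- The operator `L(1) = omega_2` on `V`. -/
def L1 : V →ₗ[ℂ] V := 𝕍.Y 2 𝕍.omega

lemma L1_pow_mem (k : ℤ) (j : ℕ) {u : V} (hu : u ∈ 𝕍.grading k) :
    (𝕍.L1 ^ j) u ∈ 𝕍.grading (k - j) := by
  induction j with
  | zero => simpa using hu
  | succ j ih =>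
    rw [pow_succ', Module.End.mul_apply]
    set v := (𝕍.L1 ^ j) u
    rw [𝕍.mem_grading_iff] at ih ⊢
    have h := 𝕍.virasoro 0 1 v
    simp only [zero_add, Int.cast_zero, Int.cast_one, one_ne_zero, if_false, zero_smul,
      add_zero, zero_sub] at h
    norm_num at h
    rw [ih, map_smul, sub_eq_iff_eq_add] at h
    change 𝕍.Y 1 𝕍.omega (𝕍.Y 2 𝕍.omega v) = _ • (𝕍.Y 2 𝕍.omega v)
    rw [h]
    push_cast
    module

lemma exists_L1_pow_eq_zero (k : ℤ) :
    ∃ J : ℕ, ∀ j ≥ J, ∀ u ∈ 𝕍.grading k, (𝕍.L1 ^ j) u = 0 := by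
  obtain ⟨N, hN⟩ := 𝕍.grading_eq_bot
  refine ⟨(k - N + 1).toNat, fun j hj u hu => ?_⟩
  have h := 𝕍.L1_pow_mem k j hu
  rw [hN (k - j) (by omega)] at h
  simpa using h

end VertexOperatorAlgebra

namespace DiscreteModule

variable {V : Type*} [AddCommGroup V] [Module ℂ V] {𝕍 : VertexOperatorAlgebra V}
  {W : Type*} [AddCommGroup W] [Module ℂ W] (M : DiscreteModule 𝕍 W)

/-- `C₁(W)`, the span of the vectors `u_{-1} w` with `u ∈ V_+` and `w ∈ W`. -/
def C₁ : Submodule ℂ W :=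
  Submodule.span ℂ {x | ∃ u ∈ 𝕍.positivePart, ∃ w : W, x = M.Y (-1) u w}

/-- `W` is `C₁`-cofinite: `dim W / C₁(W) < ∞`. -/
def C₁Cofinite : Prop := FiniteDimensional ℂ (W ⧸ M.C₁)

/-- The coefficient of `x^(-n-1)` in `Y(e^{x L(1)} (-x^{-2})^{L(0)} u, x⁻¹)` for `u` of weight
`k`, namely `∑_j (-1)^k / j! (L(1)^j u)_{2k - j - n - 2}` (a finite sum). -/
noncomputable def adjointModeHom (n k : ℤ) : 𝕍.grading k →ₗ[ℂ] W →ₗ[ℂ] W :=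
  ∑ᶠ j : ℕ, ((-1 : ℂ) ^ k / (j.factorial : ℂ)) •
    (M.Y (2 * k - j - n - 2) ∘ₗ (𝕍.L1 ^ j) ∘ₗ (𝕍.grading k).subtype)

/-- `M.adjointMode n u` is the operator `u^*_n` on `W`: the coefficient of `x^(-n-1)` in
`Y(e^{x L(1)} (-x^{-2})^{L(0)} u, x⁻¹)`, extended linearly from homogeneous `u`. -/
noncomputable def adjointMode (n : ℤ) : V →ₗ[ℂ] W →ₗ[ℂ] W :=
  letI := 𝕍.decomp.chooseDecomposition
  (DirectSum.toModule ℂ ℤ (W →ₗ[ℂ] W) (M.adjointModeHom n)) ∘ₗ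
    (DirectSum.decomposeLinearEquiv 𝕍.grading).toLinearMap

lemma adjointMode_of_mem (n k : ℤ) {u : V} (hu : u ∈ 𝕍.grading k) :
    M.adjointMode n u = M.adjointModeHom n k ⟨u, hu⟩ := by
  let _ := 𝕍.decomp.chooseDecomposition
  have h : DirectSum.decompose 𝕍.grading u
      = DirectSum.lof ℂ ℤ (fun i => 𝕍.grading i) k ⟨u, hu⟩ :=
    DirectSum.decompose_of_mem _ hu
  change DirectSum.toModule ℂ ℤ (W →ₗ[ℂ] W) (M.adjointModeHom n)
    (DirectSum.decompose 𝕍.grading u) = _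
  rw [h, DirectSum.toModule_lof]

lemma adjointModeHom_apply (n k : ℤ) (u : 𝕍.grading k) (w : W) :
    ∃ J : ℕ, M.adjointModeHom n k u w = ∑ j ∈ Finset.range J,
      ((-1 : ℂ) ^ k / (j.factorial : ℂ)) • M.Y (2 * k - j - n - 2) ((𝕍.L1 ^ j) u) w := by
  obtain ⟨J, hJ⟩ := 𝕍.exists_L1_pow_eq_zero k
  refine ⟨J, ?_⟩
  rw [adjointModeHom, finsum_eq_sum_of_support_subset (s := Finset.range J)]
  · simp [LinearMap.sum_apply]
  · intro j hj
    by_contra hj'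
    apply hj
    ext v w
    simp only [Finset.coe_range, Set.mem_Iio, not_lt] at hj'
    simp [hJ j hj' v v.2]

/-- `wt u_n = wt u - n - 1`. -/
lemma Y_mem (n k : ℤ) (r : ℝ) {u : V} {w : W} (hu : u ∈ 𝕍.grading k) (hw : w ∈ M.grading r) :
    M.Y n u w ∈ M.grading (r + k - n - 1) := by
  have hj := M.jacobi 𝕍.omega u w 0 1 n
  rw [finsum_eq_single _ 0, finsum_eq_single _ 0,
    finsum_eq_sum_of_support_subset (s := Finset.range 2)] at hj
  · rw [𝕍.mem_grading_iff] at hu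
    rw [M.mem_grading_iff] at hw ⊢
    simp [Finset.sum_range_succ, hu, hw, M.derivative] at hj
    rw [sub_eq_iff_eq_add] at hj
    rw [hj]
    push_cast
    module
  · intro i hi
    by_contra hi'
    apply hi
    have : 1 < i := by simpa using hi'
    have h0 : Ring.choose (1 : ℤ) i = 0 := by
      have := Ring.choose_natCast (R := ℤ) 1 i
      rw [Nat.choose_eq_zero_of_lt ‹1 < i›] at this
      simpa using this
    simp [h0]
  · intro i hi
    simp [Ring.choose_zero_pos ℤ (Nat.pos_of_ne_zero hi)]
  · intro i hi
    simp [Ring.choose_zero_pos ℤ (Nat.pos_of_ne_zero hi)]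

/-- `wt u^*_n = -wt u + n + 1`. -/
lemma adjointMode_mem (n k : ℤ) (r : ℝ) {u : V} {w : W} (hu : u ∈ 𝕍.grading k)
    (hw : w ∈ M.grading r) : M.adjointMode n u w ∈ M.grading (r - k + n + 1) := by
  rw [M.adjointMode_of_mem n k hu]
  obtain ⟨J, hJ⟩ := M.adjointModeHom_apply n k ⟨u, hu⟩ w
  rw [hJ]
  refine Submodule.sum_mem _ fun j _ => Submodule.smul_mem _ _ ?_
  have h := M.Y_mem (2 * k - j - n - 2) (k - j) r (𝕍.L1_pow_mem k j hu) hw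
  convert h using 2
  push_cast
  ring

/-- The graded dual `W' = ∐_r (W_(r))^*`: the linear functionals on `W` that vanish on all but
finitely many of the homogeneous subspaces. -/
def gradedDual : Submodule ℂ (Module.Dual ℂ W) where
  carrier := {f | {r : ℝ | ∃ w ∈ M.grading r, f w ≠ 0}.Finite}
  zero_mem' := by simp
  add_mem' := by
    intro f g hf hg
    refine (hf.union hg).subset ?_
    rintro r ⟨w, hw, h⟩
    by_cases h1 : f w = 0
    · exact Or.inr ⟨w, hw, by simpa [h1] using h⟩
    · exact Or.inl ⟨w, hw, h1⟩
  smul_mem' := by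
    intro c f hf
    refine Set.Finite.subset hf ?_
    rintro r ⟨w, hw, h⟩
    exact ⟨w, hw, fun h1 => h (by simp [h1])⟩

lemma comp_adjointMode_mem (n : ℤ) (u : V) {f : Module.Dual ℂ W} (hf : f ∈ M.gradedDual) :
    f ∘ₗ M.adjointMode n u ∈ M.gradedDual := by
  have hu : u ∈ ⨆ k, 𝕍.grading k := by
    rw [𝕍.decomp.submodule_iSup_eq_top]; trivial
  induction hu using Submodule.iSup_induction' with
  | mem k u hu =>
    have hf' : {r : ℝ | ∃ w ∈ M.grading r, f w ≠ 0}.Finite := hf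
    refine Set.Finite.subset (hf'.image (fun s : ℝ => s + k - n - 1)) ?_
    rintro r ⟨w, hw, h⟩
    exact ⟨r - k + n + 1, ⟨_, M.adjointMode_mem n k r hu hw, h⟩, by simp only; ring⟩
  | zero => simp
  | add u v _ _ h1 h2 =>
    rw [map_add, LinearMap.comp_add]
    exact Submodule.add_mem _ h1 h2

/-- The vertex operators of the contragredient module `W'`, determined by
`⟨Y'(u, x) w', w⟩ = ⟨w', Y(e^{x L(1)} (-x^{-2})^{L(0)} u, x⁻¹) w⟩`. -/
noncomputable def contragredient : Modes V M.gradedDual := fun n =>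
  LinearMap.mk₂ ℂ (fun u f => ⟨(f : Module.Dual ℂ W) ∘ₗ M.adjointMode n u,
      M.comp_adjointMode_mem n u f.2⟩)
    (fun u v f => by ext w; simp)
    (fun a u f => by ext w; simp)
    (fun u f g => by ext w; simp)
    (fun a u f => by ext w; simp)

end DiscreteModule

/-- An intertwining operator `𝓨(w₁, x) w₂ = ∑_{n ∈ ℝ} (w₁)_n w₂ x^(-n-1)` of type
`(W₃ over W₁ W₂)`, where `W₁`, `W₂`, `W₃` carry the vertex operators `Y₁`, `Y₂`, `Y₃`;
`mode n w₁ w₂` is `(w₁)_n w₂`.  Real exponents are enough because all the modules that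
occur are graded by real weights. -/
structure IntertwiningOperator {V W₁ W₂ W₃ : Type*} [AddCommGroup V] [Module ℂ V]
    [AddCommGroup W₁] [Module ℂ W₁] [AddCommGroup W₂] [Module ℂ W₂]
    [AddCommGroup W₃] [Module ℂ W₃] (𝕍 : VertexOperatorAlgebra V)
    (Y₁ : Modes V W₁) (Y₂ : Modes V W₂) (Y₃ : Modes V W₃) where
  mode : ℝ → W₁ →ₗ[ℂ] W₂ →ₗ[ℂ] W₃
  truncation : ∀ w₁ w₂, ∃ N : ℝ, ∀ n ≥ N, mode n w₁ w₂ = 0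
  jacobi : JacobiIdentity Y₁ Y₂ Y₃ mode
  /-- `𝓨(L(-1)w₁, x) = d/dx 𝓨(w₁, x)`, with `L(-1) = omega_0` -/
  derivative : ∀ (n : ℝ) (w₁ : W₁) (w₂ : W₂),
    mode n (Y₁ 0 𝕍.omega w₁) w₂ = (-(n : ℂ)) • mode (n - 1) w₁ w₂

/-! ### The coefficient ring and its expansions -/

open MvPolynomial in
/-- The ring `ℂ[z₁^{±1}, z₂^{±1}, (z₁ - z₂)⁻¹]`, where `z₁ = X 0` and `z₂ = X 1`. -/
abbrev CoeffRing : Type :=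
  Localization.Away (X 0 * X 1 * (X 0 - X 1) : MvPolynomial (Fin 2) ℂ)

open LaurentPolynomial in
/-- Laurent series in a variable `y` whose coefficients are Laurent polynomials in a variable `t`;
the coefficient of `t^p y^q` in `f` is `(f.coeff q).coeff p`.  The elements of the ring
`ℂ[z₁^{±1}, z₂^{±1}, (z₁ - z₂)⁻¹]` are expanded here in the region `|t| > |y| > 0`. -/
abbrev ExpansionRing : Type := LaurentSeries ℂ[T;T⁻¹]

namespace ExpansionRing

/-- the variable `y`, which is small compared with `t` -/
noncomputable def y : ExpansionRing := HahnSeries.single 1 1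

/-- the variable `t` -/
noncomputable def t : ExpansionRing := HahnSeries.C (LaurentPolynomial.T 1)

lemma isUnit_y : IsUnit y :=
  IsUnit.of_mul_eq_one (HahnSeries.single (-1) 1) (by simp [y])

lemma isUnit_t : IsUnit t := (LaurentPolynomial.isUnit_T 1).map HahnSeries.C

lemma isUnit_t_add (c : ℂ) : IsUnit (t + HahnSeries.C (LaurentPolynomial.C c) * y) := by
  set z : ExpansionRing := HahnSeries.single 1 (LaurentPolynomial.T (-1) * LaurentPolynomial.C c)
  have h : t + HahnSeries.C (LaurentPolynomial.C c) * y = t * (1 + z) := by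
    simp only [t, y, z, mul_add, mul_one, HahnSeries.C_apply, HahnSeries.single_mul_single,
      zero_add, ← mul_assoc, ← LaurentPolynomial.T_add]
    simp
  rw [h]
  refine isUnit_t.mul (HahnSeries.isUnit_of_orderTop_pos ?_)
  rw [add_sub_cancel_left]
  exact lt_of_lt_of_le (by exact_mod_cast one_pos) HahnSeries.orderTop_single_le

lemma isUnit_t_add_y : IsUnit (t + y) := by
  simpa using isUnit_t_add 1

lemma isUnit_t_sub_y : IsUnit (t - y) := by
  have h := isUnit_t_add (-1)
  rw [map_neg, map_neg, map_one, map_one] at h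
  convert h using 1
  ring

end ExpansionRing

open MvPolynomial in
/-- The ring homomorphism that substitutes `z₁ = f₁` and `z₂ = f₂`. -/
noncomputable def expand (f₁ f₂ : ExpansionRing) (h : IsUnit (f₁ * f₂ * (f₁ - f₂))) :
    CoeffRing →+* ExpansionRing :=
  IsLocalization.Away.lift (X 0 * X 1 * (X 0 - X 1) : MvPolynomial (Fin 2) ℂ)
    (g := eval₂Hom (HahnSeries.C.comp LaurentPolynomial.C) ![f₁, f₂])
    (by simpa using h)

open ExpansionRing in
/-- Expansion in the region `|z₁| > |z₂| > 0`: here `t = z₁` and `y = z₂`. -/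
noncomputable def expandProduct : CoeffRing →+* ExpansionRing :=
  expand t y ((isUnit_t.mul isUnit_y).mul isUnit_t_sub_y)

open ExpansionRing in
/-- Expansion in the region `|z₂| > |z₁ - z₂| > 0`: here `t = z₂` and `y = z₁ - z₂`. -/
noncomputable def expandIterate : CoeffRing →+* ExpansionRing :=
  expand (t + y) t ((isUnit_t_add_y.mul isUnit_t).mul
    (by rw [add_sub_cancel_left]; exact isUnit_y))

open ExpansionRing in
/-- Expansion in the region `|z₂| > |z₁| > 0`: here `t = z₂` and `y = z₁`. -/
noncomputable def expandReversed : CoeffRing →+* ExpansionRing :=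
  expand y t ((isUnit_y.mul isUnit_t).mul
    (by rw [← neg_sub]; exact isUnit_t_sub_y.neg))

/-! ### Series with real exponents and their differential equations -/

/-- Formal series `∑_{r, s ∈ ℝ} φ r s · t^r y^s` in two independent variables `t` and `y`. -/
abbrev TwoVariableSeries : Type := ℝ → ℝ → ℂ

namespace TwoVariableSeries

/-- `∂/∂t` -/
noncomputable def dt (φ : TwoVariableSeries) : TwoVariableSeries :=
  fun r s => ((r : ℂ) + 1) * φ (r + 1) s

/-- `∂/∂y` -/
noncomputable def dy (φ : TwoVariableSeries) : TwoVariableSeries :=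
  fun r s => ((s : ℂ) + 1) * φ r (s + 1)

/-- The family whose sum is the coefficient of `t^r y^s` in the product `f φ`. -/
noncomputable def mulTerm (f : ExpansionRing) (φ : TwoVariableSeries) (r s : ℝ) :
    ℤ × ℤ → ℂ :=
  fun pq => (f.coeff pq.2).coeff pq.1 * φ (r - pq.1) (s - pq.2)

/-- With `ι` the expansion of the coefficients and `D` a derivation acting on series, the series
`φ` satisfies `D^m φ + a₁ D^(m-1) φ + ⋯ + a_m φ = 0`: every product `ι(a_k) D^(m-k) φ` is
defined, that is, each of its coefficients is a finite sum, and the equation holds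
coefficient by coefficient. -/
def SatisfiesODE (φ : TwoVariableSeries) (ι : CoeffRing →+* ExpansionRing)
    (D : TwoVariableSeries → TwoVariableSeries) (m : ℕ) (a : ℕ → CoeffRing) : Prop :=
  ∀ r s : ℝ,
    (∀ k ∈ Finset.Icc 1 m, (Function.support (mulTerm (ι (a k)) (D^[m - k] φ) r s)).Finite) ∧
    (D^[m] φ) r s + ∑ k ∈ Finset.Icc 1 m, ∑ᶠ pq, mulTerm (ι (a k)) (D^[m - k] φ) r s pq = 0

end TwoVariableSeries

section Series

variable {V W₀ W₁ W₂ W₃ W : Type*} [AddCommGroup V] [Module ℂ V]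
  [AddCommGroup W₀] [Module ℂ W₀] [AddCommGroup W₁] [Module ℂ W₁]
  [AddCommGroup W₂] [Module ℂ W₂] [AddCommGroup W₃] [Module ℂ W₃]
  [AddCommGroup W] [Module ℂ W] {𝕍 : VertexOperatorAlgebra V}
  {M₀ : DiscreteModule 𝕍 W₀} {M₁ : DiscreteModule 𝕍 W₁} {M₂ : DiscreteModule 𝕍 W₂}
  {M₃ : DiscreteModule 𝕍 W₃} {M : DiscreteModule 𝕍 W}

/-- The series `⟨w₀, 𝓨(w₁, t) 𝓩(w₂, y) w₃⟩` for `𝓨` of type `(W₀' over W₁ W)` and `𝓩` of type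
`(W over W₂ W₃)`. -/
noncomputable def productSeries
    (𝓨 : IntertwiningOperator 𝕍 M₁.Y M.Y M₀.contragredient)
    (𝓩 : IntertwiningOperator 𝕍 M₂.Y M₃.Y M.Y)
    (w₀ : W₀) (w₁ : W₁) (w₂ : W₂) (w₃ : W₃) : TwoVariableSeries :=
  fun r s => (𝓨.mode (-r - 1) w₁ (𝓩.mode (-s - 1) w₂ w₃) : Module.Dual ℂ W₀) w₀

/-- The series `⟨w₀, 𝓨(𝓩(w₁, y) w₂, t) w₃⟩` for `𝓩` of type `(W over W₁ W₂)` and `𝓨` of type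
`(W₀' over W W₃)`. -/
noncomputable def iterateSeries
    (𝓩 : IntertwiningOperator 𝕍 M₁.Y M₂.Y M.Y)
    (𝓨 : IntertwiningOperator 𝕍 M.Y M₃.Y M₀.contragredient)
    (w₀ : W₀) (w₁ : W₁) (w₂ : W₂) (w₃ : W₃) : TwoVariableSeries :=
  fun r s => (𝓨.mode (-r - 1) (𝓩.mode (-s - 1) w₁ w₂) w₃ : Module.Dual ℂ W₀) w₀

end Series

namespace TwoVariableSeries

/-- `φ`, a series in `t = z₁` and `y = z₂`, satisfies in the region `|z₁| > |z₂| > 0` the system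
`∂₁^m φ + ∑ a_k ∂₁^(m-k) φ = 0`, `∂₂^n φ + ∑ b_l ∂₂^(n-l) φ = 0`, with `∂ᵢ = ∂/∂zᵢ`. -/
def SatisfiesProductSystem (φ : TwoVariableSeries) (m n : ℕ) (a b : ℕ → CoeffRing) : Prop :=
  φ.SatisfiesODE expandProduct dt m a ∧ φ.SatisfiesODE expandProduct dy n b

/-- The same system for a series `φ` in `t = z₂` and `y = z₁ - z₂`, in the region
`|z₂| > |z₁ - z₂| > 0`.  By the chain rule `∂/∂z₁ = ∂/∂y` and `∂/∂z₂ = ∂/∂t - ∂/∂y`. -/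
def SatisfiesIterateSystem (φ : TwoVariableSeries) (m n : ℕ) (a b : ℕ → CoeffRing) : Prop :=
  φ.SatisfiesODE expandIterate dy m a ∧
    φ.SatisfiesODE expandIterate (fun ψ => dt ψ - dy ψ) n b

/-- The same system for a series `φ` in `t = z₂` and `y = z₁`, in the region
`|z₂| > |z₁| > 0`. -/
def SatisfiesReversedSystem (φ : TwoVariableSeries) (m n : ℕ) (a b : ℕ → CoeffRing) : Prop :=
  φ.SatisfiesODE expandReversed dy m a ∧ φ.SatisfiesODE expandReversed dt n b

end TwoVariableSeries

/-! All three series are expansions of one kind of object: a four-point function with insertions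
`w₀` at infinity, `w₁` at z₁, `w₂` at z₂ and `w₃` at 0. Inserting f(x) Y(u, x) dx, with f having
poles only at these points, and adding up residues gives linear relations over R between values of
the function. The relations are the same for products, iterates and reversed products; only the
expansion of their coefficients changes. They are collected in `ResidueRelations` and derived from
the Jacobi identity by binomial identities (`residueRelations_productFunctional`,
`residueRelations_iterateFunctional`, `ResidueRelations.swap`).

A relation whose f has a simple pole at an insertion trades u_{-1} w, with wt u > 0, for vectors of
smaller total weight; at infinity this needs the involutivity of the adjoint,
`Y_eq_sum_adjointMode`. By C₁-cofiniteness every homogeneous vector of large weight is a sum of such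
u_{-1} w (`C₁Cofinite.exists_grading_le`). Weights are bounded below, so descent on the total weight
shows that all values lie in the R-module generated by the values at vectors of bounded weight
(`exists_mem_of_lowWeight_mem`). Those vectors form finite-dimensional spaces, so this module is
finitely generated.

As R is Noetherian, the values at L(-1)^i `w₁`, i = 0, 1, 2, ..., satisfy a monic relation over R.
By the L(-1)-derivative property it is a differential equation in z₁; powers of L(-1) on `w₂` give
the equation in z₂.

For coefficients independent of the intertwining operators, the argument is run once, on the product
of all functionals that satisfy the relations (`universalFunctional`). A monic relation there
projects to every factor. -/

/-! ### The action of `ExpansionRing` on series that are bounded below in `y` -/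

/-- Formal series `∑_{r ∈ ℝ} g r · t^r`. -/
def RealExponentSeries : Type := ℝ → ℂ

namespace RealExponentSeries

noncomputable instance : AddCommGroup RealExponentSeries := inferInstanceAs (AddCommGroup (ℝ → ℂ))

noncomputable instance : Module ℂ RealExponentSeries := inferInstanceAs (Module ℂ (ℝ → ℂ))

lemma sum_apply {ι : Type*} (A : Finset ι) (g : ι → RealExponentSeries) (r : ℝ) :
    (∑ i ∈ A, g i) r = ∑ i ∈ A, g i r :=
  Finset.sum_apply r A (fun i => (g i : ℝ → ℂ))

/-- Multiplication by the integral powers of `t`. -/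
noncomputable def shift : Multiplicative ℤ →* Module.End ℂ RealExponentSeries where
  toFun n :=
    { toFun := fun g r => g (r - (n.toAdd : ℤ))
      map_add' := fun _ _ => rfl
      map_smul' := fun _ _ => rfl }
  map_one' := by
    ext g; funext r
    change g _ = g _
    simp
  map_mul' m n := by
    ext g; funext r
    change g _ = g _
    congr 1
    rw [toAdd_mul, Int.cast_add]
    abel

/-- Translation of exponents represents the group of monomials in t, and the universal property of
the group algebra extends it to Laurent polynomials. -/
noncomputable instance : Module (LaurentPolynomial ℂ) RealExponentSeries :=
  Module.compHom _ (AddMonoidAlgebra.lift ℂ (Module.End ℂ RealExponentSeries) ℤ shift).toRingHom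

lemma laurent_smul_apply (f : LaurentPolynomial ℂ) (g : RealExponentSeries) (r : ℝ) :
    (f • g) r = ∑ p ∈ f.coeff.support, f.coeff p * g (r - p) := by
  change (AddMonoidAlgebra.lift ℂ (Module.End ℂ RealExponentSeries) ℤ shift f g) r = _
  rw [AddMonoidAlgebra.lift_apply, Finsupp.sum, LinearMap.sum_apply]
  rw [sum_apply]
  rfl

end RealExponentSeries

namespace TwoVariableSeries

/-- The series in which the exponents of `y` are bounded below. -/
def boundedBelow : Submodule ℂ TwoVariableSeries where
  carrier := {φ | ∃ B : ℝ, ∀ r s, s < B → φ r s = 0}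
  zero_mem' := ⟨0, fun _ _ _ => rfl⟩
  add_mem' := by
    rintro φ ψ ⟨B, hB⟩ ⟨B', hB'⟩
    refine ⟨min B B', fun r s h => ?_⟩
    rw [lt_min_iff] at h
    simp [hB r s h.1, hB' r s h.2]
  smul_mem' := by
    rintro c φ ⟨B, hB⟩
    exact ⟨B, fun r s h => by simp [hB r s h]⟩

/-- The part of a series with exponents of `y` in `s₀ + ℤ`, as a Laurent series in `y`. -/
noncomputable def hahnPart (s₀ : ℝ) :
    boundedBelow →+ HahnModule ℤ (LaurentPolynomial ℂ) RealExponentSeries where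
  toFun φ := HahnModule.of _
    { coeff := fun q r => φ.1 r (s₀ + q)
      isPWO_support' := by
        obtain ⟨B, hB⟩ := φ.2
        have hb : BddBelow (Function.support
            fun q : ℤ => (fun r => φ.1 r (s₀ + q) : RealExponentSeries)) := by
          -- A set of integers that is bounded below is well founded, which is all that a Hahn
          -- series in y requires.
          refine ⟨⌊B - s₀⌋, fun q hq => ?_⟩
          by_contra hlt
          apply hq
          funext r
          refine hB r _ ?_
          have : (q : ℝ) + 1 ≤ ⌊B - s₀⌋ := by exact_mod_cast (by omega : q + 1 ≤ ⌊B - s₀⌋)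
          have := Int.floor_le (B - s₀)
          linarith
        exact hb.isWF.isPWO }
  map_zero' := rfl
  map_add' _ _ := rfl

lemma coeff_hahnPart (s₀ : ℝ) (φ : boundedBelow) (q : ℤ) (r : ℝ) :
    ((HahnModule.of _).symm (hahnPart s₀ φ)).coeff q r = φ.1 r (s₀ + q) := rfl

/-- All real `s₀` are used rather than representatives of ℝ/ℤ. The redundancy is harmless, and the
coefficient at `s` is read off at `s₀ = s`, `q = 0`. -/
lemma hahnPart_injective : Function.Injective (AddMonoidHom.pi hahnPart) := by
  intro φ ψ h
  ext r s
  have := congrArg (fun x : HahnModule ℤ (LaurentPolynomial ℂ) RealExponentSeries =>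
    ((HahnModule.of (LaurentPolynomial ℂ)).symm x).coeff 0 r) (congrFun h s)
  change φ.1 r (s + (0 : ℤ)) = ψ.1 r (s + (0 : ℤ)) at this
  simpa using this

/-- Integral powers of y preserve each coset of exponents `s₀ + ℤ`, so multiplication can be carried
out one coset at a time, where it is the action on a Hahn module. Well-ordered supports leave
finitely many powers of y, and each Laurent polynomial has finitely many powers of t. -/
lemma coeff_smul_hahnPart (f : ExpansionRing) (φ : boundedBelow) (s₀ : ℝ) (q : ℤ) (r : ℝ) :
    (Function.support (mulTerm f φ.1 r (s₀ + q))).Finite ∧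
    ((HahnModule.of _).symm (f • hahnPart s₀ φ)).coeff q r
      = ∑ᶠ pq, mulTerm f φ.1 r (s₀ + q) pq := by
  classical
  rw [HahnModule.coeff_smul]
  set A := Finset.VAddAntidiagonal q (Set.VAddAntidiagonal.finite_of_isPWO f.isPWO_support
    ((HahnModule.of (LaurentPolynomial ℂ)).symm (hahnPart s₀ φ)).isPWO_support q) with hA
  set D := A.image Prod.fst
  set P := D.biUnion (fun i => (f.coeff i).coeff.support)
  have hsub : Function.support (mulTerm f φ.1 r (s₀ + q)) ⊆ ↑(P ×ˢ D) := by
    rintro ⟨p, i⟩ h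
    simp only [mulTerm, Function.mem_support, ne_eq, mul_eq_zero, not_or] at h
    have hi : i ∈ D := by
      refine Finset.mem_image.2 ⟨(i, q - i), ?_, rfl⟩
      rw [hA, Finset.mem_vaddAntidiagonal]
      refine ⟨fun h0 => h.1 ?_, fun h0 => h.2 ?_, by simp⟩
      · change f.coeff i = 0 at h0
        simp [h0]
      · have := congrFun h0 (r - p)
        rw [coeff_hahnPart] at this
        rw [show s₀ + q - i = s₀ + ((q - i : ℤ) : ℝ) by push_cast; ring]
        exact this
    simp only [Finset.coe_product, Set.mem_prod, Finset.mem_coe]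
    exact ⟨Finset.mem_biUnion.2 ⟨i, hi, Finsupp.mem_support_iff.2 h.1⟩, hi⟩
  refine ⟨(Finset.finite_toSet _).subset hsub, ?_⟩
  rw [finsum_eq_sum_of_support_subset _ hsub, Finset.sum_product_right]
  rw [Finset.sum_image]
  · rw [RealExponentSeries.sum_apply]
    refine Finset.sum_congr rfl fun x hx => ?_
    rw [RealExponentSeries.laurent_smul_apply]
    have hx' := ((Finset.mem_vaddAntidiagonal _ _).1 hx).2.2
    refine Finset.sum_subset_zero_on_sdiff ?_ ?_ ?_
    · exact Finset.subset_biUnion_of_mem (fun i => (f.coeff i).coeff.support)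
        (Finset.mem_image_of_mem _ hx)
    · intro p hp
      have : (f.coeff x.1).coeff p = 0 := by
        simpa using (Finset.mem_sdiff.1 hp).2
      simp [mulTerm, this]
    · intro p hp
      have hs : s₀ + (q : ℝ) - (x.1 : ℝ) = s₀ + x.2 := by
        rw [← hx', vadd_eq_add, Int.cast_add]
        ring
      rw [coeff_hahnPart, mulTerm, hs]
  -- The two exponents of y add up to `q`, so the first determines the pair.
  · intro x hx x' hx' h
    have h1 := ((Finset.mem_vaddAntidiagonal _ _).1 hx).2.2
    have h2 := ((Finset.mem_vaddAntidiagonal _ _).1 hx').2.2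
    simp only [vadd_eq_add] at h1 h2
    ext <;> omega

lemma finite_support_mulTerm (f : ExpansionRing) (φ : boundedBelow) (r s : ℝ) :
    (Function.support (mulTerm f φ.1 r s)).Finite := by
  simpa using (coeff_smul_hahnPart f φ s 0 r).1

/-- The product of `φ` and the elements of `ExpansionRing`. -/
noncomputable instance : SMul ExpansionRing boundedBelow where
  smul f φ := ⟨fun r s => ∑ᶠ pq, mulTerm f φ.1 r s pq, by
    obtain ⟨B, hB⟩ := φ.2
    -- Below this bound either the factor from `f` or the one from `φ` vanishes.
    refine ⟨B + f.order, fun r s hs => ?_⟩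
    refine (finsum_congr fun pq => ?_).trans finsum_zero
    by_cases h : pq.2 < f.order
    · simp [mulTerm, HahnSeries.coeff_eq_zero_of_lt_order h]
    · have : (f.order : ℝ) ≤ pq.2 := by exact_mod_cast not_lt.1 h
      simp [mulTerm, hB _ (s - pq.2) (by linarith)]⟩

lemma smul_apply (f : ExpansionRing) (φ : boundedBelow) (r s : ℝ) :
    (f • φ).1 r s = ∑ᶠ pq, mulTerm f φ.1 r s pq := rfl

/-- The module axioms, associativity in particular, are inherited from the Hahn modules through the
injective map to all coset parts. -/
noncomputable instance : Module ExpansionRing boundedBelow :=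
  Function.Injective.module ExpansionRing
    (AddMonoidHom.pi hahnPart : boundedBelow →+ (ℝ → _)) hahnPart_injective (by
      intro f φ
      funext s₀
      apply HahnModule.ext
      funext q r
      exact (coeff_smul_hahnPart f φ s₀ q r).2.symm)

lemma single_smul_apply (a b : ℤ) (c : ℂ) (φ : boundedBelow) (r s : ℝ) :
    ((HahnSeries.single b (LaurentPolynomial.C c * LaurentPolynomial.T a) : ExpansionRing) • φ).1
      r s = c * φ.1 (r - a) (s - b) := by
  rw [smul_apply, finsum_eq_single _ (a, b)]
  · simp [mulTerm, ← LaurentPolynomial.single_eq_C_mul_T]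
  · rintro ⟨p, q⟩ h
    by_cases hq : q = b
    · subst hq
      have hp : p ≠ a := fun h' => h (by rw [h'])
      simp [mulTerm, ← LaurentPolynomial.single_eq_C_mul_T, hp]
    · simp [mulTerm, HahnSeries.coeff_single_of_ne hq]

end TwoVariableSeries

lemma LaurentPolynomial.coeff_C_mul_T (a : ℂ) (n m : ℤ) :
    (LaurentPolynomial.C a * LaurentPolynomial.T n).coeff m = if n = m then a else 0 := by
  rw [← LaurentPolynomial.single_eq_C_mul_T, AddMonoidAlgebra.coeff_single, Finsupp.single_apply]

/-! ### Units of `ExpansionRing` and their powers -/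

namespace ExpansionRing

/-- `t` as a unit. -/
noncomputable def tUnit : ExpansionRingˣ := isUnit_t.unit

/-- `y` as a unit. -/
noncomputable def yUnit : ExpansionRingˣ := isUnit_y.unit

/-- `t + c y` as a unit. -/
noncomputable def tAddUnit (c : ℂ) : ExpansionRingˣ := (isUnit_t_add c).unit

/-- The expansion `∑_q choose(p, q) c^q t^(p-q) y^q` of `(t + c y)^p`. -/
noncomputable def binomialSeries (c : ℂ) (p : ℤ) : ExpansionRing :=
  HahnSeries.ofPowerSeries ℤ _ (PowerSeries.mk fun q : ℕ =>
    LaurentPolynomial.C (((Ring.choose p q : ℤ) : ℂ) * c ^ q) * LaurentPolynomial.T (p - q))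

lemma coe_tUnit_zpow (n : ℤ) :
    ((tUnit ^ n : ExpansionRingˣ) : ExpansionRing)
      = HahnSeries.single 0 (LaurentPolynomial.C 1 * LaurentPolynomial.T n) := by
  induction n using Int.induction_on with
  | zero => simp
  | succ n ih =>
    rw [zpow_add_one, Units.val_mul, ih]
    simp [tUnit, t, HahnSeries.single_mul_single, LaurentPolynomial.T_add,
      -LaurentPolynomial.T_mul]
  | pred n ih =>
    rw [← tUnit.isUnit.mul_left_inj, ← Units.val_mul, ← zpow_add_one, sub_add_cancel, ih]
    simp [tUnit, t, HahnSeries.single_mul_single, ← LaurentPolynomial.T_add,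
      -LaurentPolynomial.T_mul]

lemma coe_yUnit_zpow (n : ℤ) :
    ((yUnit ^ n : ExpansionRingˣ) : ExpansionRing)
      = HahnSeries.single n (LaurentPolynomial.C 1 * LaurentPolynomial.T 0) := by
  induction n using Int.induction_on with
  | zero => simp
  | succ n ih =>
    rw [zpow_add_one, Units.val_mul, ih]
    simp [yUnit, y, HahnSeries.single_mul_single]
  | pred n ih =>
    rw [← yUnit.isUnit.mul_left_inj, ← Units.val_mul, ← zpow_add_one, sub_add_cancel, ih]
    simp [yUnit, y, HahnSeries.single_mul_single]

/-- Comparing coefficients of y^(q+1) gives Pascal's rule, which holds for every integer upper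
index. Hence one identity serves for both positive and negative powers. -/
lemma t_add_mul_binomialSeries (c : ℂ) (p : ℤ) :
    (t + HahnSeries.C (LaurentPolynomial.C c) * y) * binomialSeries c p
      = binomialSeries c (p + 1) := by
  have hty : t + HahnSeries.C (LaurentPolynomial.C c) * y = HahnSeries.ofPowerSeries ℤ _
      (PowerSeries.C (LaurentPolynomial.T 1) + PowerSeries.C (LaurentPolynomial.C c)
        * PowerSeries.X) := by
    simp [t, y, HahnSeries.ofPowerSeries_C, HahnSeries.ofPowerSeries_X]
  rw [hty, binomialSeries, binomialSeries, ← map_mul]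
  congr 1
  ext1 q
  rw [add_mul, mul_assoc, map_add, PowerSeries.coeff_C_mul, PowerSeries.coeff_C_mul]
  cases q with
  | zero =>
    simp [← LaurentPolynomial.T_add, add_comm, -LaurentPolynomial.T_mul]
  | succ q =>
    rw [PowerSeries.coeff_succ_X_mul]
    simp only [PowerSeries.coeff_mk]
    rw [Ring.choose_succ_succ]
    rw [mul_left_comm, ← LaurentPolynomial.T_add, ← mul_assoc, ← map_mul]
    rw [show (1 + (p - ((q + 1 : ℕ) : ℤ))) = p - q by push_cast; ring,
      show p + 1 - ((q + 1 : ℕ) : ℤ) = p - q by push_cast; ring, ← add_mul, ← map_add]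
    congr 2
    push_cast
    ring

lemma binomialSeries_zero (c : ℂ) : binomialSeries c 0 = 1 := by
  rw [binomialSeries, ← map_one (HahnSeries.ofPowerSeries ℤ _)]
  congr 1
  ext1 q
  cases q with
  | zero => simp
  | succ q => simp [Ring.choose_zero_succ]

lemma coe_tAddUnit_zpow (c : ℂ) (p : ℤ) :
    ((tAddUnit c ^ p : ExpansionRingˣ) : ExpansionRing) = binomialSeries c p := by
  induction p using Int.induction_on with
  | zero => simp [binomialSeries_zero]
  | succ n ih =>
    rw [zpow_add_one, mul_comm (tAddUnit c ^ _), Units.val_mul, ih, ← t_add_mul_binomialSeries]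
    rfl
  | pred n ih =>
    rw [← (tAddUnit c).isUnit.mul_right_inj, ← Units.val_mul, ← zpow_one_add, add_sub_cancel, ih]
    change _ = (t + HahnSeries.C (LaurentPolynomial.C c) * y) * _
    rw [t_add_mul_binomialSeries, sub_add_cancel]

lemma coeff_binomialSeries_natCast (c : ℂ) (p : ℤ) (q : ℕ) :
    (binomialSeries c p).coeff q
      = LaurentPolynomial.C (((Ring.choose p q : ℤ) : ℂ) * c ^ q) * LaurentPolynomial.T (p - q) := by
  rw [binomialSeries, HahnSeries.ofPowerSeries_apply_coeff, PowerSeries.coeff_mk]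

lemma coeff_binomialSeries_of_neg (c : ℂ) (p : ℤ) {q : ℤ} (hq : q < 0) :
    (binomialSeries c p).coeff q = 0 := by
  rw [binomialSeries, HahnSeries.ofPowerSeries_apply]
  apply HahnSeries.embDomain_of_notMem_range
  rintro ⟨n, rfl⟩
  exact absurd hq (not_lt.2 (Int.natCast_nonneg n))

end ExpansionRing

namespace TwoVariableSeries

open ExpansionRing

lemma tUnit_zpow_smul_apply (n : ℤ) (φ : boundedBelow) (r s : ℝ) :
    (((tUnit ^ n : ExpansionRingˣ) : ExpansionRing) • φ).1 r s = φ.1 (r - n) s := by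
  rw [coe_tUnit_zpow, single_smul_apply]
  simp

lemma yUnit_zpow_smul_apply (n : ℤ) (φ : boundedBelow) (r s : ℝ) :
    (((yUnit ^ n : ExpansionRingˣ) : ExpansionRing) • φ).1 r s = φ.1 r (s - n) := by
  rw [coe_yUnit_zpow, single_smul_apply]
  simp

lemma tAddUnit_zpow_smul_apply (c : ℂ) (p : ℤ) (φ : boundedBelow) (r s : ℝ) :
    (((tAddUnit c ^ p : ExpansionRingˣ) : ExpansionRing) • φ).1 r s
      = ∑ᶠ q : ℕ, ((Ring.choose p q : ℤ) : ℂ) * c ^ q * φ.1 (r - p + q) (s - q) := by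
  rw [coe_tAddUnit_zpow, smul_apply]
  -- The coefficient of y^q is a multiple of the single monomial t^(p-q), so the double sum runs
  -- only along these pairs.
  have hinj : Function.Injective fun q : ℕ => ((p - q, q) : ℤ × ℤ) := by
    intro q q' h
    simpa using congrArg Prod.snd h
  have hsupp : Function.support (mulTerm (binomialSeries c p) φ.1 r s)
      ⊆ Set.range fun q : ℕ => ((p - q, q) : ℤ × ℤ) := by
    rintro ⟨a, b⟩ h
    rcases lt_or_ge b 0 with hb | hb
    · simp [mulTerm, coeff_binomialSeries_of_neg c p hb] at h
    · lift b to ℕ using hb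
      rw [Function.mem_support, mulTerm, coeff_binomialSeries_natCast,
        LaurentPolynomial.coeff_C_mul_T] at h
      refine ⟨b, ?_⟩
      by_contra hne
      apply h
      have : p - b ≠ a := fun h' => hne (by rw [← h'])
      simp [this]
  rw [← finsum_mem_univ, ← finsum_mem_inter_support_eq' _ (Set.range _) Set.univ
    (fun x hx => by simpa using hsupp hx), finsum_mem_range hinj]
  refine finsum_congr fun q => ?_
  simp only [mulTerm, coeff_binomialSeries_natCast, LaurentPolynomial.coeff_C_mul_T]
  simp [sub_add]

/-- The pointwise complex structure agrees with the one through constant series; this compatibility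
is what makes ℂ, R and the series a scalar tower. -/
lemma C_C_smul (c : ℂ) (φ : boundedBelow) :
    (HahnSeries.C (LaurentPolynomial.C c) : ExpansionRing) • φ = c • φ := by
  ext r s
  have : (HahnSeries.C (LaurentPolynomial.C c) : ExpansionRing)
      = HahnSeries.single 0 (LaurentPolynomial.C c * LaurentPolynomial.T 0) := by
    rw [LaurentPolynomial.T_zero, mul_one, HahnSeries.C_apply]
  rw [this, single_smul_apply]
  simp

end TwoVariableSeries

/-! ### Homogeneous components and `C₁`-cofiniteness -/

namespace DiscreteModule

variable {V : Type*} [AddCommGroup V] [Module ℂ V] {𝕍 : VertexOperatorAlgebra V}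
  {W : Type*} [AddCommGroup W] [Module ℂ W] (M : DiscreteModule 𝕍 W)

lemma adjointMode_eq_sum (n k : ℤ) {u : V} (hu : u ∈ 𝕍.grading k) (w : W) {J : ℕ}
    (hJ : ∀ j ≥ J, (𝕍.L1 ^ j) u = 0) :
    M.adjointMode n u w = ∑ j ∈ Finset.range J,
      ((-1 : ℂ) ^ k / (j.factorial : ℂ)) • M.Y (2 * k - j - n - 2) ((𝕍.L1 ^ j) u) w := by
  obtain ⟨J', hJ'⟩ := 𝕍.exists_L1_pow_eq_zero k
  rw [M.adjointMode_of_mem n k hu, adjointModeHom,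
    finsum_eq_sum_of_support_subset (s := Finset.range (max J J'))]
  · rw [LinearMap.sum_apply, LinearMap.sum_apply]
    symm
    apply Finset.sum_subset (Finset.range_mono (le_max_left _ _))
    intro j _ hj
    simp [hJ j (by simpa using hj)]
  · intro j hj
    by_contra hj'
    apply hj
    ext v w
    simp only [Finset.coe_range, Set.mem_Iio, not_lt, max_le_iff] at hj'
    simp [hJ' j hj'.2 v v.2]

/-- This is the expansion of (1 - 1)^n / n!, that is, e^{-x} e^{x} = 1 coefficient by coefficient.
-/
lemma sum_antidiagonal_neg_one_pow_div_factorial (n : ℕ) :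
    ∑ i ∈ Finset.range (n + 1), (-1 : ℂ) ^ i / (i.factorial * (n - i).factorial)
      = if n = 0 then 1 else 0 := by
  have h := Finset.sum_congr rfl fun i (hi : i ∈ Finset.range (n + 1)) =>
    show (-1 : ℂ) ^ i / (i.factorial * (n - i).factorial)
      = (-1 : ℂ) ^ i * n.choose i / n.factorial by
    rw [Nat.cast_choose ℂ (Nat.lt_succ_iff.1 (Finset.mem_range.1 hi))]
    have := Nat.factorial_ne_zero n
    field_simp
  rw [h, ← Finset.sum_div]
  have h2 := congrArg (Int.cast : ℤ → ℂ) (Int.alternating_sum_range_choose (n := n))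
  push_cast at h2
  rw [h2]
  split_ifs with h0
  · simp [h0]
  · simp

/-- Taking adjoints of modes is an involution. -/
lemma Y_eq_sum_adjointMode (m k : ℤ) {u : V} (hu : u ∈ 𝕍.grading k) (w : W) {J : ℕ}
    (hJ : ∀ j ≥ J, (𝕍.L1 ^ j) u = 0) :
    M.Y m u w = ∑ j ∈ Finset.range J,
      ((-1 : ℂ) ^ k / (j.factorial : ℂ)) •
        M.adjointMode (2 * k - j - m - 2) ((𝕍.L1 ^ j) u) w := by
  have hk : ((-1 : ℂ) ^ k) * ((-1 : ℂ) ^ k) = 1 := by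
    rw [← mul_zpow]; simp
  -- L(1)^j u has weight k - j, so the two signs combine to (-1)^k (-1)^(k-j) = (-1)^j.
  have h : ∀ j ∈ Finset.range J, ((-1 : ℂ) ^ k / (j.factorial : ℂ)) •
        M.adjointMode (2 * k - j - m - 2) ((𝕍.L1 ^ j) u) w
      = ∑ i ∈ Finset.range (J - j), ((-1 : ℂ) ^ j / (j.factorial * i.factorial)) •
        M.Y (m - (j + i : ℕ)) ((𝕍.L1 ^ (j + i)) u) w := by
    intro j hj
    have hj' := Finset.mem_range.1 hj
    rw [M.adjointMode_eq_sum _ _ (𝕍.L1_pow_mem k j hu) w (J := J - j), Finset.smul_sum]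
    · refine Finset.sum_congr rfl fun i _ => ?_
      rw [smul_smul, ← Module.End.mul_apply, ← pow_add, add_comm i j]
      congr 1
      · rw [zpow_sub₀ (by norm_num), zpow_natCast]
        have h1 : ((-1 : ℂ) ^ j) * ((-1 : ℂ) ^ j) = 1 := by rw [← mul_pow]; simp
        have h2 : ((-1 : ℂ) ^ j) ≠ 0 := by simp
        have h3 : (j.factorial : ℂ) ≠ 0 := by exact_mod_cast j.factorial_ne_zero
        have h4 : (i.factorial : ℂ) ≠ 0 := by exact_mod_cast i.factorial_ne_zero
        rw [div_mul_div_comm, div_eq_div_iff (mul_ne_zero h3 h4) (mul_ne_zero h3 h4),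
          ← mul_div_assoc, hk, one_div, inv_eq_of_mul_eq_one_left h1]
      · rw [show 2 * (k - j) - i - (2 * k - j - m - 2) - 2 = m - ((j + i : ℕ) : ℤ) by
          push_cast; ring]
    · intro i hi
      rw [← Module.End.mul_apply, ← pow_add]
      exact hJ _ (by omega)
  rw [Finset.sum_congr rfl h]
  -- Grouping by n = j + i makes the mode depend on n alone; the alternating sum then leaves only n
  -- = 0.
  rw [← Finset.sum_range_diag_flip J (fun j i => ((-1 : ℂ) ^ j / (j.factorial * i.factorial)) •
        M.Y (m - (j + i : ℕ)) ((𝕍.L1 ^ (j + i)) u) w)]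
  have h3 : ∀ n ∈ Finset.range J, ∑ j ∈ Finset.range (n + 1),
      ((-1 : ℂ) ^ j / (j.factorial * (n - j).factorial)) •
        M.Y (m - (j + (n - j) : ℕ)) ((𝕍.L1 ^ (j + (n - j))) u) w
      = if n = 0 then M.Y m u w else 0 := by
    intro n _
    have h4 : ∀ j ∈ Finset.range (n + 1), ((-1 : ℂ) ^ j / (j.factorial * (n - j).factorial)) •
        M.Y (m - (j + (n - j) : ℕ)) ((𝕍.L1 ^ (j + (n - j))) u) w
        = ((-1 : ℂ) ^ j / (j.factorial * (n - j).factorial)) •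
          M.Y (m - n) ((𝕍.L1 ^ n) u) w := by
      intro j hj
      rw [Nat.add_sub_cancel' (Nat.lt_succ_iff.1 (Finset.mem_range.1 hj))]
    rw [Finset.sum_congr rfl h4, ← Finset.sum_smul, sum_antidiagonal_neg_one_pow_div_factorial]
    split_ifs with h0
    · simp [h0]
    · simp
  rw [Finset.sum_congr rfl h3]
  -- `J = 0` forces u = 0, so that the empty sum is correct.
  rcases Nat.eq_zero_or_pos J with hJ0 | hJ0
  · have := hJ 0 (by omega)
    simp only [pow_zero, Module.End.one_apply] at this
    simp [this]
  · rw [Finset.sum_ite_eq' (Finset.range J) 0]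
    simp [hJ0]

/-- Nonzero vectors from distinct homogeneous subspaces of weight at most 0 are linearly independent
in a finite-dimensional space. So only finitely many such weights occur, and they are bounded below.
-/
lemma exists_grading_eq_bot : ∃ B : ℝ, ∀ r < B, M.grading r = ⊥ := by
  set U : Submodule ℂ W := ⨆ s : Set.Iic (0 : ℝ), M.grading s
  have : FiniteDimensional ℂ U := M.discrete 0
  let I := {s : ℝ // s ≤ 0 ∧ M.grading s ≠ ⊥}
  have hex : ∀ i : I, ∃ v ∈ M.grading i.1, v ≠ 0 := fun i => Submodule.exists_mem_ne_zero_of_ne_bot i.2.2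
  choose v hv hv0 using hex
  have hind : iSupIndep fun i : I => M.grading i.1 :=
    M.decomp.submodule_iSupIndep.comp Subtype.val_injective
  have hlin : LinearIndependent ℂ v := hind.linearIndependent _ hv hv0
  have hvU : ∀ i, v i ∈ U := fun i =>
    Submodule.mem_iSup_of_mem (p := fun s : Set.Iic (0 : ℝ) => M.grading s) ⟨i.1, i.2.1⟩ (hv i)
  have hlin' : LinearIndependent ℂ (fun i => (⟨v i, hvU i⟩ : U)) :=
    LinearIndependent.of_comp U.subtype hlin
  have hfin : Finite I := hlin'.finite
  have hfin' : {s : ℝ | s ≤ 0 ∧ M.grading s ≠ ⊥}.Finite := @Set.toFinite _ _ hfin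
  obtain ⟨B, hB⟩ := hfin'.bddBelow
  refine ⟨min B 0, fun r hr => ?_⟩
  by_contra hne
  rw [lt_min_iff] at hr
  exact absurd (hB ⟨hr.2.le, hne⟩) (not_le.2 hr.1)

/-- The part of `C₁(W)` of weight `r`. -/
def homogeneousC₁ (r : ℝ) : Submodule ℂ W :=
  Submodule.span ℂ {x | ∃ k : ℤ, 0 < k ∧ ∃ u ∈ 𝕍.grading k, ∃ w ∈ M.grading (r - k),
    x = M.Y (-1) u w}

lemma homogeneousC₁_le (r : ℝ) : M.homogeneousC₁ r ≤ M.grading r := by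
  refine Submodule.span_le.2 ?_
  rintro _ ⟨k, _, u, hu, w, hw, rfl⟩
  have := M.Y_mem (-1) k (r - k) hu hw
  rwa [show r - (k : ℝ) + k - ((-1 : ℤ) : ℝ) - 1 = r by push_cast; ring] at this

lemma C₁_le_iSup : M.C₁ ≤ ⨆ r, M.homogeneousC₁ r := by
  refine Submodule.span_le.2 ?_
  rintro _ ⟨u, hu, w, rfl⟩
  have hw : w ∈ ⨆ r, M.grading r := by
    rw [M.decomp.submodule_iSup_eq_top]; trivial
  have key : ∀ k : Set.Ioi (0 : ℤ), ∀ u ∈ 𝕍.grading k, ∀ w ∈ ⨆ r, M.grading r,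
      M.Y (-1) u w ∈ ⨆ r, M.homogeneousC₁ r := by
    intro k u hu w hw
    have : (⨆ r, M.grading r) ≤ (⨆ r, M.homogeneousC₁ r).comap (M.Y (-1) u) := by
      refine iSup_le fun r w hw => ?_
      refine Submodule.mem_iSup_of_mem (r + k) (Submodule.subset_span
        ⟨k, k.2, u, hu, w, ?_, rfl⟩)
      simpa using hw
    exact this hw
  have : 𝕍.positivePart ≤ (⨆ r, M.homogeneousC₁ r).comap ((M.Y (-1)).flip w) :=
    iSup_le fun k u hu => key k u hu w hw
  exact this hu

/-- The projection onto weight `r` fixes `w`, kills the weights at most `N`, and maps C₁(W) into its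
own part of weight `r`, because C₁(W) is spanned by homogeneous vectors. -/
lemma mem_homogeneousC₁_of_mem_C₁_sup {N r : ℝ} (hr : N < r) {w : W} (hw : w ∈ M.grading r)
    (h : w ∈ M.C₁ ⊔ ⨆ s : Set.Iic N, M.grading s) : w ∈ M.homogeneousC₁ r := by
  classical
  let _ := M.decomp.chooseDecomposition
  let π : W →ₗ[ℂ] W := (M.grading r).subtype ∘ₗ DirectSum.component ℂ ℝ (fun i => M.grading i) r ∘ₗ
    (DirectSum.decomposeLinearEquiv M.grading).toLinearMap
  have hsame : ∀ x ∈ M.grading r, π x = x := fun x hx => DirectSum.decompose_of_mem_same _ hx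
  have hne : ∀ s, s ≠ r → ∀ x ∈ M.grading s, π x = 0 := fun s hs x hx =>
    DirectSum.decompose_of_mem_ne _ hx hs
  have h1 : M.C₁ ⊔ (⨆ s : Set.Iic N, M.grading s) ≤ (M.homogeneousC₁ r).comap π := by
    refine sup_le (M.C₁_le_iSup.trans (iSup_le fun s x hx => ?_)) (iSup_le fun s x hx => ?_)
    · by_cases hs : s = r
      · subst hs
        rw [Submodule.mem_comap, hsame _ (M.homogeneousC₁_le _ hx)]
        exact hx
      · rw [Submodule.mem_comap, hne s hs _ (M.homogeneousC₁_le _ hx)]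
        exact zero_mem _
    · have hs : (s : ℝ) ≠ r := (lt_of_le_of_lt s.2 hr).ne
      rw [Submodule.mem_comap, hne s hs _ hx]
      exact zero_mem _
  have := h1 h
  rwa [Submodule.mem_comap, hsame w hw] at this

/-- W is the increasing union of its parts of weight at most N. Their images exhaust the
finite-dimensional quotient, hence one of them is already the whole quotient; above that N, W and
C₁(W) coincide in each weight. -/
lemma C₁Cofinite.exists_grading_le (h : M.C₁Cofinite) :
    ∃ N : ℝ, ∀ r > N, M.grading r ≤ M.homogeneousC₁ r := by
  have hfg : (⊤ : Submodule ℂ (W ⧸ M.C₁)).FG := Module.finite_def.1 h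
  have hmono : Monotone fun N : ℝ => ⨆ s : Set.Iic N, M.grading s := by
    intro N N' hN
    exact iSup_le fun s => le_iSup (fun s : Set.Iic N' => M.grading s) ⟨s.1, s.2.trans hN⟩
  have hsup : (⊤ : Submodule ℂ (W ⧸ M.C₁))
      ≤ ⨆ N : ℝ, (⨆ s : Set.Iic N, M.grading s).map M.C₁.mkQ := by
    rw [← Submodule.map_iSup]
    have : (⨆ N : ℝ, ⨆ s : Set.Iic N, M.grading s) = ⊤ := by
      rw [eq_top_iff, ← M.decomp.submodule_iSup_eq_top]
      exact iSup_le fun r => le_iSup_of_le r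
        (le_iSup (fun s : Set.Iic r => M.grading s) ⟨r, Set.mem_Iic.2 le_rfl⟩)
    rw [this, Submodule.map_top, Submodule.range_mkQ]
  obtain ⟨_, ⟨N, rfl⟩, hN⟩ := (Submodule.fg_iff_compact _).1 hfg _ _ (Set.range_nonempty _)
    (Monotone.directed_le fun N N' h => Submodule.map_mono (hmono h)).directedOn_range
    (isLUB_iSup (f := fun N : ℝ => (⨆ s : Set.Iic N, M.grading s).map M.C₁.mkQ)) hsup
  refine ⟨N, fun r hr w hw => M.mem_homogeneousC₁_of_mem_C₁_sup hr hw ?_⟩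
  obtain ⟨x, hx, hxw⟩ := hN (Submodule.mem_top (x := M.C₁.mkQ w))
  have : w - x ∈ M.C₁ := by
    rw [← Submodule.Quotient.eq]
    exact hxw.symm
  rw [← sub_add_cancel w x]
  exact add_mem (Submodule.mem_sup_left this) (Submodule.mem_sup_right hx)

end DiscreteModule

/-! ### Residue relations and finite generation -/

section ResidueRelations

variable {V W₀ W₁ W₂ W₃ : Type*} [AddCommGroup V] [Module ℂ V]
  [AddCommGroup W₀] [Module ℂ W₀] [AddCommGroup W₁] [Module ℂ W₁]
  [AddCommGroup W₂] [Module ℂ W₂] [AddCommGroup W₃] [Module ℂ W₃]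
  {𝕍 : VertexOperatorAlgebra V}

/-- The relations between the values of a four-point function `F`, with insertions `w₀` at `∞`,
`w₁` at `z₁`, `w₂` at `z₂` and `w₃` at `0`, that the residue theorem gives for the insertion of
`f(x) Y(u, x) dx`, where `f` is `(x - z₁)⁻¹`, `(x - z₂)⁻¹` or `x^m`.  Here `d = z₁ - z₂`. -/
structure ResidueRelations (M₀ : DiscreteModule 𝕍 W₀) (M₁ : DiscreteModule 𝕍 W₁)
    (M₂ : DiscreteModule 𝕍 W₂) (M₃ : DiscreteModule 𝕍 W₃) {A S : Type*} [CommRing A]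
    [AddCommGroup S] [Module ℂ S] [Module A S] (z₁ z₂ d : Aˣ)
    (F : W₀ → W₁ → W₂ → W₃ → S) : Prop where
  linear₀ : ∀ w₁ w₂ w₃, IsLinearMap ℂ fun w₀ => F w₀ w₁ w₂ w₃
  linear₁ : ∀ w₀ w₂ w₃, IsLinearMap ℂ fun w₁ => F w₀ w₁ w₂ w₃
  linear₂ : ∀ w₀ w₁ w₃, IsLinearMap ℂ fun w₂ => F w₀ w₁ w₂ w₃
  linear₃ : ∀ w₀ w₁ w₂, IsLinearMap ℂ fun w₃ => F w₀ w₁ w₂ w₃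
  -- The sums are the expansions of f at infinity and at the two other points. `N` is any common
  -- truncation bound, because infinite sums have no meaning in an abstract module.
  pole₁ : ∀ (u : V) (w₀ : W₀) (w₁ : W₁) (w₂ : W₂) (w₃ : W₃) (N : ℕ),
    (∀ i : ℕ, N ≤ i → M₀.adjointMode (-1 - i) u w₀ = 0) →
    (∀ i : ℕ, N ≤ i → M₂.Y i u w₂ = 0) → (∀ i : ℕ, N ≤ i → M₃.Y i u w₃ = 0) →
    F w₀ (M₁.Y (-1) u w₁) w₂ w₃
      = ∑ i ∈ Finset.range N,
          ((z₁ ^ (i : ℤ) : Aˣ) : A) • F (M₀.adjointMode (-1 - i) u w₀) w₁ w₂ w₃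
        + ∑ i ∈ Finset.range N, ((d ^ (-1 - i : ℤ) : Aˣ) : A) • F w₀ w₁ (M₂.Y i u w₂) w₃
        + ∑ i ∈ Finset.range N, ((z₁ ^ (-1 - i : ℤ) : Aˣ) : A) • F w₀ w₁ w₂ (M₃.Y i u w₃)
  pole₂ : ∀ (u : V) (w₀ : W₀) (w₁ : W₁) (w₂ : W₂) (w₃ : W₃) (N : ℕ),
    (∀ i : ℕ, N ≤ i → M₀.adjointMode (-1 - i) u w₀ = 0) →
    (∀ i : ℕ, N ≤ i → M₁.Y i u w₁ = 0) → (∀ i : ℕ, N ≤ i → M₃.Y i u w₃ = 0) →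
    F w₀ w₁ (M₂.Y (-1) u w₂) w₃
      = ∑ i ∈ Finset.range N,
          ((z₂ ^ (i : ℤ) : Aˣ) : A) • F (M₀.adjointMode (-1 - i) u w₀) w₁ w₂ w₃
        + ∑ i ∈ Finset.range N, (((-d) ^ (-1 - i : ℤ) : Aˣ) : A) • F w₀ (M₁.Y i u w₁) w₂ w₃
        + ∑ i ∈ Finset.range N, ((z₂ ^ (-1 - i : ℤ) : Aˣ) : A) • F w₀ w₁ w₂ (M₃.Y i u w₃)
  pole_zero : ∀ (m : ℤ) (u : V) (w₀ : W₀) (w₁ : W₁) (w₂ : W₂) (w₃ : W₃) (N : ℕ),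
    (∀ i : ℕ, N ≤ i → M₁.Y i u w₁ = 0) → (∀ i : ℕ, N ≤ i → M₂.Y i u w₂ = 0) →
    F (M₀.adjointMode m u w₀) w₁ w₂ w₃
      = ∑ i ∈ Finset.range N,
          Ring.choose m i • ((z₁ ^ (m - i : ℤ) : Aˣ) : A) • F w₀ (M₁.Y i u w₁) w₂ w₃
        + ∑ i ∈ Finset.range N,
          Ring.choose m i • ((z₂ ^ (m - i : ℤ) : Aˣ) : A) • F w₀ w₁ (M₂.Y i u w₂) w₃
        + F w₀ w₁ w₂ (M₃.Y m u w₃)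

namespace ResidueRelations

variable {M₀ : DiscreteModule 𝕍 W₀} {M₁ : DiscreteModule 𝕍 W₁}
    {M₂ : DiscreteModule 𝕍 W₂} {M₃ : DiscreteModule 𝕍 W₃} {A S : Type*} [CommRing A]
    [AddCommGroup S] [Module ℂ S] [Module A S] {z₁ z₂ d : Aˣ}
    {F : W₀ → W₁ → W₂ → W₃ → S}

/-- Interchanging the two insertions at finite nonzero points. -/
lemma swap (h : ResidueRelations M₀ M₁ M₂ M₃ z₁ z₂ d F) :
    ResidueRelations M₀ M₂ M₁ M₃ z₂ z₁ (-d) fun w₀ w₂ w₁ w₃ => F w₀ w₁ w₂ w₃ where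
  linear₀ _ _ _ := h.linear₀ _ _ _
  linear₁ _ _ _ := h.linear₂ _ _ _
  linear₂ _ _ _ := h.linear₁ _ _ _
  linear₃ _ _ _ := h.linear₃ _ _ _
  pole₁ u w₀ w₁ w₂ w₃ N h₀ h₂ h₃ := h.pole₂ u w₀ w₂ w₁ w₃ N h₀ h₂ h₃
  pole₂ u w₀ w₁ w₂ w₃ N h₀ h₂ h₃ := by
    simpa using h.pole₁ u w₀ w₂ w₁ w₃ N h₀ h₂ h₃
  pole_zero m u w₀ w₁ w₂ w₃ N h₁ h₂ := by
    rw [h.pole_zero m u w₀ w₂ w₁ w₃ N h₂ h₁]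
    abel

end ResidueRelations

lemma exists_nat_forall_eq_zero {W : Type*} [Zero W] {f : ℤ → W} (h : ∃ N : ℤ, ∀ n ≥ N, f n = 0) :
    ∃ N : ℕ, ∀ i : ℕ, N ≤ i → f i = 0 := by
  obtain ⟨N, hN⟩ := h
  exact ⟨N.toNat, fun i hi => hN _ (by omega)⟩

/-- The vector has weight r - k - i, which eventually falls below the lowest weight. -/
lemma DiscreteModule.exists_adjointMode_eq_zero (M₀ : DiscreteModule 𝕍 W₀) (u : V) (w₀ : W₀) {k : ℤ}
    {r : ℝ} (hu : u ∈ 𝕍.grading k) (hw : w₀ ∈ M₀.grading r) :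
    ∃ N : ℕ, ∀ i : ℕ, N ≤ i → M₀.adjointMode (-1 - i) u w₀ = 0 := by
  obtain ⟨B, hB⟩ := M₀.exists_grading_eq_bot
  obtain ⟨N, hN⟩ := exists_nat_gt (r - k - B)
  refine ⟨N, fun i hi => ?_⟩
  have h := M₀.adjointMode_mem (-1 - i) k r hu hw
  have hi' : (N : ℝ) ≤ i := by exact_mod_cast hi
  rw [hB] at h
  · simpa using h
  · push_cast
    linarith

/-- If a linear map sends every element of each `p i` into `G`, it sends `⨆ i, p i` into `G`. -/
lemma IsLinearMap.mem_of_mem_iSup {W Q R ι : Type*} [AddCommGroup W] [Module ℂ W] [CommRing R]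
    [Algebra ℂ R] [AddCommGroup Q] [Module ℂ Q] [Module R Q] [IsScalarTower ℂ R Q]
    {f : W → Q} (hf : IsLinearMap ℂ f) (G : Submodule R Q) {p : ι → Submodule ℂ W}
    (h : ∀ i, ∀ w ∈ p i, f w ∈ G) {w : W} (hw : w ∈ ⨆ i, p i) : f w ∈ G := by
  have : (⨆ i, p i) ≤ (G.restrictScalars ℂ).comap (hf.mk' f) := iSup_le fun i w hw => h i w hw
  exact this hw

lemma IsLinearMap.mem_of_mem_span {W Q R : Type*} [AddCommGroup W] [Module ℂ W] [CommRing R]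
    [Algebra ℂ R] [AddCommGroup Q] [Module ℂ Q] [Module R Q] [IsScalarTower ℂ R Q]
    {f : W → Q} (hf : IsLinearMap ℂ f) (G : Submodule R Q) {s : Set W}
    (h : ∀ w ∈ s, f w ∈ G) {w : W} (hw : w ∈ Submodule.span ℂ s) : f w ∈ G := by
  have : Submodule.span ℂ s ≤ (G.restrictScalars ℂ).comap (hf.mk' f) := Submodule.span_le.2 h
  exact this hw

namespace ResidueRelations

variable {M₀ : DiscreteModule 𝕍 W₀} {M₁ : DiscreteModule 𝕍 W₁}
    {M₂ : DiscreteModule 𝕍 W₂} {M₃ : DiscreteModule 𝕍 W₃} {R Q : Type*} [CommRing R]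
    [Algebra ℂ R] [AddCommGroup Q] [Module ℂ Q] [Module R Q] [IsScalarTower ℂ R Q]
    {z₁ z₂ d : Rˣ} {F : W₀ → W₁ → W₂ → W₃ → Q}

/-- `F` takes values in `G` on homogeneous vectors of total weight at most `σ`. -/
def MemOfWeightLE (M₀ : DiscreteModule 𝕍 W₀) (M₁ : DiscreteModule 𝕍 W₁)
    (M₂ : DiscreteModule 𝕍 W₂) (M₃ : DiscreteModule 𝕍 W₃) (F : W₀ → W₁ → W₂ → W₃ → Q)
    (G : Submodule R Q) (σ : ℝ) : Prop :=
  ∀ r₀ r₁ r₂ r₃ : ℝ, r₀ + r₁ + r₂ + r₃ ≤ σ → ∀ w₀ ∈ M₀.grading r₀, ∀ w₁ ∈ M₁.grading r₁,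
    ∀ w₂ ∈ M₂.grading r₂, ∀ w₃ ∈ M₃.grading r₃, F w₀ w₁ w₂ w₃ ∈ G

/-- With w₁ = u_{-1} w and σ the original total weight, the terms at z₂ and 0 have total weight σ -
1 - i and the terms at infinity σ - 2k - i. The condition k > 0 is what makes the latter drop. -/
lemma mem_of_homogeneousC₁₁ (h : ResidueRelations M₀ M₁ M₂ M₃ z₁ z₂ d F) (G : Submodule R Q)
    {r₀ r₁ r₂ r₃ : ℝ} (hG : MemOfWeightLE M₀ M₁ M₂ M₃ F G (r₀ + r₁ + r₂ + r₃ - 1))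
    {w₀ : W₀} {w₁ : W₁} {w₂ : W₂} {w₃ : W₃} (hw₀ : w₀ ∈ M₀.grading r₀)
    (hw₁ : w₁ ∈ M₁.homogeneousC₁ r₁) (hw₂ : w₂ ∈ M₂.grading r₂) (hw₃ : w₃ ∈ M₃.grading r₃) :
    F w₀ w₁ w₂ w₃ ∈ G := by
  refine (h.linear₁ w₀ w₂ w₃).mem_of_mem_span G ?_ hw₁
  rintro _ ⟨k, hk, u, hu, w, hw, rfl⟩
  have hk' : (1 : ℝ) ≤ k := by exact_mod_cast hk
  obtain ⟨N₀, hN₀⟩ := M₀.exists_adjointMode_eq_zero u w₀ hu hw₀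
  obtain ⟨N₂, hN₂⟩ := exists_nat_forall_eq_zero (M₂.truncation u w₂)
  obtain ⟨N₃, hN₃⟩ := exists_nat_forall_eq_zero (M₃.truncation u w₃)
  rw [h.pole₁ u w₀ w w₂ w₃ (N₀ + N₂ + N₃) (fun i hi => hN₀ i (by omega))
    (fun i hi => hN₂ i (by omega)) (fun i hi => hN₃ i (by omega))]
  refine add_mem (add_mem ?_ ?_) ?_ <;>
    refine sum_mem fun i _ => G.smul_mem _ ?_ <;>
    have hi : (0 : ℝ) ≤ i := i.cast_nonneg
  · refine hG _ _ _ _ ?_ _ (M₀.adjointMode_mem _ k r₀ hu hw₀) _ hw _ hw₂ _ hw₃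
    push_cast
    linarith
  · refine hG _ _ _ _ ?_ _ hw₀ _ hw _ (M₂.Y_mem _ k r₂ hu hw₂) _ hw₃
    push_cast
    linarith
  · refine hG _ _ _ _ ?_ _ hw₀ _ hw _ hw₂ _ (M₃.Y_mem _ k r₃ hu hw₃)
    push_cast
    linarith

lemma mem_of_homogeneousC₁₂ (h : ResidueRelations M₀ M₁ M₂ M₃ z₁ z₂ d F) (G : Submodule R Q)
    {r₀ r₁ r₂ r₃ : ℝ} (hG : MemOfWeightLE M₀ M₁ M₂ M₃ F G (r₀ + r₁ + r₂ + r₃ - 1))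
    {w₀ : W₀} {w₁ : W₁} {w₂ : W₂} {w₃ : W₃} (hw₀ : w₀ ∈ M₀.grading r₀)
    (hw₁ : w₁ ∈ M₁.grading r₁) (hw₂ : w₂ ∈ M₂.homogeneousC₁ r₂) (hw₃ : w₃ ∈ M₃.grading r₃) :
    F w₀ w₁ w₂ w₃ ∈ G := by
  refine h.swap.mem_of_homogeneousC₁₁ G ?_ hw₀ hw₂ hw₁ hw₃
  intro s₀ s₁ s₂ s₃ hs v₀ hv₀ v₁ hv₁ v₂ hv₂ v₃ hv₃
  exact hG s₀ s₂ s₁ s₃ (by linarith) v₀ hv₀ v₂ hv₂ v₁ hv₁ v₃ hv₃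

/-- The relation for f = 1/x is solved for its term at 0. -/
lemma mem_of_homogeneousC₁₃ (h : ResidueRelations M₀ M₁ M₂ M₃ z₁ z₂ d F) (G : Submodule R Q)
    {r₀ r₁ r₂ r₃ : ℝ} (hG : MemOfWeightLE M₀ M₁ M₂ M₃ F G (r₀ + r₁ + r₂ + r₃ - 1))
    {w₀ : W₀} {w₁ : W₁} {w₂ : W₂} {w₃ : W₃} (hw₀ : w₀ ∈ M₀.grading r₀)
    (hw₁ : w₁ ∈ M₁.grading r₁) (hw₂ : w₂ ∈ M₂.grading r₂) (hw₃ : w₃ ∈ M₃.homogeneousC₁ r₃) :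
    F w₀ w₁ w₂ w₃ ∈ G := by
  refine (h.linear₃ w₀ w₁ w₂).mem_of_mem_span G ?_ hw₃
  rintro _ ⟨k, hk, u, hu, w, hw, rfl⟩
  have hk' : (1 : ℝ) ≤ k := by exact_mod_cast hk
  obtain ⟨N₁, hN₁⟩ := exists_nat_forall_eq_zero (M₁.truncation u w₁)
  obtain ⟨N₂, hN₂⟩ := exists_nat_forall_eq_zero (M₂.truncation u w₂)
  have := h.pole_zero (-1) u w₀ w₁ w₂ w (N₁ + N₂) (fun i hi => hN₁ i (by omega))
    (fun i hi => hN₂ i (by omega))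
  rw [← sub_eq_iff_eq_add'] at this
  rw [← this]
  refine sub_mem ?_ (add_mem ?_ ?_)
  · refine hG _ _ _ _ ?_ _ (M₀.adjointMode_mem _ k r₀ hu hw₀) _ hw₁ _ hw₂ _ hw
    push_cast
    linarith
  all_goals
    refine sum_mem fun i _ => zsmul_mem (G.smul_mem _ ?_) _
    have hi : (0 : ℝ) ≤ i := i.cast_nonneg
  · refine hG _ _ _ _ ?_ _ hw₀ _ (M₁.Y_mem _ k r₁ hu hw₁) _ hw₂ _ hw
    push_cast
    linarith
  · refine hG _ _ _ _ ?_ _ hw₀ _ hw₁ _ (M₂.Y_mem _ k r₂ hu hw₂) _ hw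
    push_cast
    linarith

/-- The relations contain adjoint modes on `w₀`, not u_{-1}. Involutivity rewrites u_{-1} w through
adjoint modes of index 2k - j - 1 of L(1)^j u, and f = x^(2k-j-1) then moves each to the finite
points. The term at 0 loses 2k in total weight, the others j + i + 1. -/
lemma mem_of_homogeneousC₁₀ (h : ResidueRelations M₀ M₁ M₂ M₃ z₁ z₂ d F) (G : Submodule R Q)
    {r₀ r₁ r₂ r₃ : ℝ} (hG : MemOfWeightLE M₀ M₁ M₂ M₃ F G (r₀ + r₁ + r₂ + r₃ - 1))
    {w₀ : W₀} {w₁ : W₁} {w₂ : W₂} {w₃ : W₃} (hw₀ : w₀ ∈ M₀.homogeneousC₁ r₀)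
    (hw₁ : w₁ ∈ M₁.grading r₁) (hw₂ : w₂ ∈ M₂.grading r₂) (hw₃ : w₃ ∈ M₃.grading r₃) :
    F w₀ w₁ w₂ w₃ ∈ G := by
  refine (h.linear₀ w₁ w₂ w₃).mem_of_mem_span G ?_ hw₀
  rintro _ ⟨k, hk, u, hu, w, hw, rfl⟩
  have hk' : (1 : ℝ) ≤ k := by exact_mod_cast hk
  obtain ⟨J, hJ⟩ := 𝕍.exists_L1_pow_eq_zero k
  rw [M₀.Y_eq_sum_adjointMode (-1) k hu w fun j hj => hJ j hj u hu]
  refine (h.linear₀ w₁ w₂ w₃).mem_of_mem_span G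
    (s := Set.range fun j : ℕ => M₀.adjointMode (2 * k - j - (-1) - 2) ((𝕍.L1 ^ j) u) w) ?_
    (sum_mem fun j _ => Submodule.smul_mem _ _ (Submodule.subset_span ⟨j, rfl⟩))
  rintro _ ⟨j, rfl⟩
  have hv := 𝕍.L1_pow_mem k j hu
  beta_reduce
  generalize (𝕍.L1 ^ j) u = v at hv ⊢
  have hj : (0 : ℝ) ≤ j := j.cast_nonneg
  obtain ⟨N₁, hN₁⟩ := exists_nat_forall_eq_zero (M₁.truncation v w₁)
  obtain ⟨N₂, hN₂⟩ := exists_nat_forall_eq_zero (M₂.truncation v w₂)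
  rw [h.pole_zero _ v w w₁ w₂ w₃ (N₁ + N₂) (fun i hi => hN₁ i (by omega))
    (fun i hi => hN₂ i (by omega))]
  refine add_mem (add_mem ?_ ?_) ?_
  rotate_left 2
  · refine hG _ _ _ _ ?_ _ hw _ hw₁ _ hw₂ _ (M₃.Y_mem _ _ r₃ hv hw₃)
    push_cast
    linarith
  all_goals
    refine sum_mem fun i _ => zsmul_mem (G.smul_mem _ ?_) _
    have hi : (0 : ℝ) ≤ i := i.cast_nonneg
  · refine hG _ _ _ _ ?_ _ hw _ (M₁.Y_mem _ _ r₁ hv hw₁) _ hw₂ _ hw₃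
    push_cast
    linarith
  · refine hG _ _ _ _ ?_ _ hw _ hw₁ _ (M₂.Y_mem _ _ r₂ hv hw₂) _ hw₃
    push_cast
    linarith

/-- For `C₁`-cofinite modules the values of `F` are generated, over the ring of coefficients, by
the values at vectors of bounded weight. -/
theorem exists_mem_of_lowWeight_mem (h₀ : M₀.C₁Cofinite) (h₁ : M₁.C₁Cofinite)
    (h₂ : M₂.C₁Cofinite) (h₃ : M₃.C₁Cofinite)
    (h : ResidueRelations M₀ M₁ M₂ M₃ z₁ z₂ d F) :
    ∃ N : ℝ, ∀ G : Submodule R Q,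
      (∀ w₀ ∈ ⨆ s : Set.Iic N, M₀.grading s, ∀ w₁ ∈ ⨆ s : Set.Iic N, M₁.grading s,
        ∀ w₂ ∈ ⨆ s : Set.Iic N, M₂.grading s, ∀ w₃ ∈ ⨆ s : Set.Iic N, M₃.grading s,
        F w₀ w₁ w₂ w₃ ∈ G) →
      ∀ w₀ w₁ w₂ w₃, F w₀ w₁ w₂ w₃ ∈ G := by
  obtain ⟨N₀, hN₀⟩ := h₀.exists_grading_le
  obtain ⟨N₁, hN₁⟩ := h₁.exists_grading_le
  obtain ⟨N₂, hN₂⟩ := h₂.exists_grading_le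
  obtain ⟨N₃, hN₃⟩ := h₃.exists_grading_le
  obtain ⟨B₀, hB₀⟩ := M₀.exists_grading_eq_bot
  obtain ⟨B₁, hB₁⟩ := M₁.exists_grading_eq_bot
  obtain ⟨B₂, hB₂⟩ := M₂.exists_grading_eq_bot
  obtain ⟨B₃, hB₃⟩ := M₃.exists_grading_eq_bot
  set N := max (max N₀ N₁) (max N₂ N₃) with hN
  have hN0 : N₀ ≤ N := (le_max_left _ _).trans (le_max_left _ _)
  have hN1 : N₁ ≤ N := (le_max_right _ _).trans (le_max_left _ _)
  have hN2 : N₂ ≤ N := (le_max_left _ _).trans (le_max_right _ _)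
  have hN3 : N₃ ≤ N := (le_max_right _ _).trans (le_max_right _ _)
  refine ⟨N, fun G hG => ?_⟩
  -- Descent on the total weight in unit steps. The induction starts below the sum of the lowest
  -- weights, where one of the four vectors must vanish.
  have key : ∀ n : ℕ, MemOfWeightLE M₀ M₁ M₂ M₃ F G (B₀ + B₁ + B₂ + B₃ - 1 + n) := by
    intro n
    induction n with
    | zero =>
      intro r₀ r₁ r₂ r₃ hr w₀ hw₀ w₁ hw₁ w₂ hw₂ w₃ hw₃
      by_cases c₀ : r₀ < B₀
      · rw [hB₀ _ c₀, Submodule.mem_bot] at hw₀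
        rw [hw₀, (h.linear₀ w₁ w₂ w₃).map_zero]
        exact G.zero_mem
      by_cases c₁ : r₁ < B₁
      · rw [hB₁ _ c₁, Submodule.mem_bot] at hw₁
        rw [hw₁, (h.linear₁ w₀ w₂ w₃).map_zero]
        exact G.zero_mem
      by_cases c₂ : r₂ < B₂
      · rw [hB₂ _ c₂, Submodule.mem_bot] at hw₂
        rw [hw₂, (h.linear₂ w₀ w₁ w₃).map_zero]
        exact G.zero_mem
      by_cases c₃ : r₃ < B₃
      · rw [hB₃ _ c₃, Submodule.mem_bot] at hw₃
        rw [hw₃, (h.linear₃ w₀ w₁ w₂).map_zero]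
        exact G.zero_mem
      push_cast at hr
      linarith
    | succ n ih =>
      intro r₀ r₁ r₂ r₃ hr w₀ hw₀ w₁ hw₁ w₂ hw₂ w₃ hw₃
      have ih' : MemOfWeightLE M₀ M₁ M₂ M₃ F G (r₀ + r₁ + r₂ + r₃ - 1) := by
        intro s₀ s₁ s₂ s₃ hs
        refine ih s₀ s₁ s₂ s₃ ?_
        push_cast at hr
        linarith
      by_cases c₀ : N₀ < r₀
      · exact h.mem_of_homogeneousC₁₀ G ih' (hN₀ r₀ c₀ hw₀) hw₁ hw₂ hw₃
      by_cases c₁ : N₁ < r₁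
      · exact h.mem_of_homogeneousC₁₁ G ih' hw₀ (hN₁ r₁ c₁ hw₁) hw₂ hw₃
      by_cases c₂ : N₂ < r₂
      · exact h.mem_of_homogeneousC₁₂ G ih' hw₀ hw₁ (hN₂ r₂ c₂ hw₂) hw₃
      by_cases c₃ : N₃ < r₃
      · exact h.mem_of_homogeneousC₁₃ G ih' hw₀ hw₁ hw₂ (hN₃ r₃ c₃ hw₃)
      -- No weight exceeds its threshold: these are the values that generate.
      rw [not_lt] at c₀ c₁ c₂ c₃
      exact hG _ (Submodule.mem_iSup_of_mem (⟨r₀, c₀.trans hN0⟩ : Set.Iic N) hw₀)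
        _ (Submodule.mem_iSup_of_mem (⟨r₁, c₁.trans hN1⟩ : Set.Iic N) hw₁)
        _ (Submodule.mem_iSup_of_mem (⟨r₂, c₂.trans hN2⟩ : Set.Iic N) hw₂)
        _ (Submodule.mem_iSup_of_mem (⟨r₃, c₃.trans hN3⟩ : Set.Iic N) hw₃)
  intro w₀ w₁ w₂ w₃
  have top₀ : w₀ ∈ ⨆ r, M₀.grading r := by rw [M₀.decomp.submodule_iSup_eq_top]; trivial
  have top₁ : w₁ ∈ ⨆ r, M₁.grading r := by rw [M₁.decomp.submodule_iSup_eq_top]; trivial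
  have top₂ : w₂ ∈ ⨆ r, M₂.grading r := by rw [M₂.decomp.submodule_iSup_eq_top]; trivial
  have top₃ : w₃ ∈ ⨆ r, M₃.grading r := by rw [M₃.decomp.submodule_iSup_eq_top]; trivial
  refine (h.linear₀ w₁ w₂ w₃).mem_of_mem_iSup G (fun r₀ w₀ hw₀ => ?_) top₀
  refine (h.linear₁ w₀ w₂ w₃).mem_of_mem_iSup G (fun r₁ w₁ hw₁ => ?_) top₁
  refine (h.linear₂ w₀ w₁ w₃).mem_of_mem_iSup G (fun r₂ w₂ hw₂ => ?_) top₂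
  refine (h.linear₃ w₀ w₁ w₂).mem_of_mem_iSup G (fun r₃ w₃ hw₃ => ?_) top₃
  obtain ⟨n, hn⟩ := exists_nat_ge (r₀ + r₁ + r₂ + r₃ - (B₀ + B₁ + B₂ + B₃ - 1))
  exact key n r₀ r₁ r₂ r₃ (by linarith) w₀ hw₀ w₁ hw₁ w₂ hw₂ w₃ hw₃

/-- Discreteness makes the spaces of bounded weight finite-dimensional, so by multilinearity the
values at tuples from four finite spanning sets generate everything. -/
theorem exists_fg_forall_mem (h₀ : M₀.C₁Cofinite) (h₁ : M₁.C₁Cofinite)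
    (h₂ : M₂.C₁Cofinite) (h₃ : M₃.C₁Cofinite)
    (h : ResidueRelations M₀ M₁ M₂ M₃ z₁ z₂ d F) :
    ∃ G : Submodule R Q, G.FG ∧ ∀ w₀ w₁ w₂ w₃, F w₀ w₁ w₂ w₃ ∈ G := by
  obtain ⟨N, hN⟩ := h.exists_mem_of_lowWeight_mem h₀ h₁ h₂ h₃
  obtain ⟨b₀, hb₀⟩ := Module.Finite.iff_fg.1 (M₀.discrete N)
  obtain ⟨b₁, hb₁⟩ := Module.Finite.iff_fg.1 (M₁.discrete N)
  obtain ⟨b₂, hb₂⟩ := Module.Finite.iff_fg.1 (M₂.discrete N)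
  obtain ⟨b₃, hb₃⟩ := Module.Finite.iff_fg.1 (M₃.discrete N)
  let X : Set Q := (fun w : W₀ × W₁ × W₂ × W₃ => F w.1 w.2.1 w.2.2.1 w.2.2.2) ''
    ((b₀ : Set W₀) ×ˢ (b₁ : Set W₁) ×ˢ (b₂ : Set W₂) ×ˢ (b₃ : Set W₃))
  have hX : X.Finite := (b₀.finite_toSet.prod
    (b₁.finite_toSet.prod (b₂.finite_toSet.prod b₃.finite_toSet))).image _
  refine ⟨Submodule.span R X, Submodule.fg_span hX, hN _ ?_⟩
  intro w₀ hw₀ w₁ hw₁ w₂ hw₂ w₃ hw₃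
  rw [← hb₀] at hw₀
  rw [← hb₁] at hw₁
  rw [← hb₂] at hw₂
  rw [← hb₃] at hw₃
  refine (h.linear₀ w₁ w₂ w₃).mem_of_mem_span _ (fun w₀ hw₀ => ?_) hw₀
  refine (h.linear₁ w₀ w₂ w₃).mem_of_mem_span _ (fun w₁ hw₁ => ?_) hw₁
  refine (h.linear₂ w₀ w₁ w₃).mem_of_mem_span _ (fun w₂ hw₂ => ?_) hw₂
  refine (h.linear₃ w₀ w₁ w₂).mem_of_mem_span _ (fun w₃ hw₃ => ?_) hw₃
  exact Submodule.subset_span ⟨(w₀, w₁, w₂, w₃), ⟨hw₀, hw₁, hw₂, hw₃⟩, rfl⟩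

end ResidueRelations

/-- A sequence in a finitely generated module over a Noetherian ring satisfies a monic relation. -/
lemma Submodule.FG.exists_monic_relation {R Q : Type*} [CommRing R] [IsNoetherianRing R]
    [AddCommGroup Q] [Module R Q] {G : Submodule R Q} (hG : G.FG) (x : ℕ → Q)
    (hx : ∀ i, x i ∈ G) :
    ∃ (m : ℕ) (a : ℕ → R), 0 < m ∧ x m + ∑ k ∈ Finset.Icc 1 m, a k • x (m - k) = 0 := by
  have hnoeth : IsNoetherian R G := isNoetherian_of_fg_of_noetherian G hG
  let f : ℕ →o Submodule R G :=
    { toFun := fun n => Submodule.span R ((fun i => (⟨x i, hx i⟩ : G)) '' Set.Iio n)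
      monotone' := fun n n' h => Submodule.span_mono (Set.image_mono (Set.Iio_subset_Iio h)) }
  obtain ⟨n, hn⟩ := monotone_stabilizes_iff_noetherian.2 hnoeth f
  -- The chain is constant from `n` on, so `x (n + 1)` already lies in the span of its predecessors.
  -- Using `n + 1` instead of `n` keeps the order positive.
  have hmem : (⟨x (n + 1), hx _⟩ : G) ∈ f (n + 1) := by
    rw [← hn (n + 1) (by omega), hn (n + 2) (by omega)]
    exact Submodule.subset_span ⟨n + 1, by simp, rfl⟩
  change _ ∈ Submodule.span R _ at hmem
  have himg : (fun i => (⟨x i, hx i⟩ : G)) '' Set.Iio (n + 1)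
      = (fun i => (⟨x i, hx i⟩ : G)) '' ↑(Finset.range (n + 1)) := by
    rw [Finset.coe_range]
  rw [himg, Submodule.mem_span_image_finset_iff_exists_fun] at hmem
  obtain ⟨c, hc⟩ := hmem
  have hc' := congrArg Subtype.val hc
  rw [AddSubmonoidClass.coe_finsetSum] at hc'
  simp only [SetLike.val_smul] at hc'
  let e : ℕ → R := fun i => if h : i ∈ Finset.range (n + 1) then c ⟨i, h⟩ else 0
  have he : ∑ i ∈ Finset.range (n + 1), e i • x i = x (n + 1) := by
    rw [← hc', ← Finset.sum_coe_sort]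
    exact Finset.sum_congr rfl fun i _ => by simp only [e, dif_pos i.2, Subtype.coe_eta]
  refine ⟨n + 1, fun k => -e (n + 1 - k), by omega, ?_⟩
  have hsum : ∑ k ∈ Finset.Icc 1 (n + 1), -e (n + 1 - k) • x (n + 1 - k)
      = ∑ i ∈ Finset.range (n + 1), -e i • x i := by
    refine Finset.sum_nbij' (fun k => n + 1 - k) (fun i => n + 1 - i) ?_ ?_ ?_ ?_ ?_
    · intro k hk
      rw [Finset.mem_Icc] at hk
      rw [Finset.mem_range]
      omega
    · intro i hi
      rw [Finset.mem_range] at hi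
      rw [Finset.mem_Icc]
      omega
    · intro k hk
      rw [Finset.mem_Icc] at hk
      omega
    · intro i hi
      rw [Finset.mem_range] at hi
      omega
    · intro k _
      rfl
  rw [hsum, ← he, ← Finset.sum_add_distrib]
  simp

/-! ### Relations that hold uniformly for all four-point functions -/

variable (M₀ : DiscreteModule 𝕍 W₀) (M₁ : DiscreteModule 𝕍 W₁)
  (M₂ : DiscreteModule 𝕍 W₂) (M₃ : DiscreteModule 𝕍 W₃) {R : Type*} [CommRing R] [Algebra ℂ R]
  (z₁ z₂ d : Rˣ)

/-- A four-point function that satisfies the residue relations, with values in a module in the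
lowest universe. -/
structure ResidueFunctional where
  /-- the module of values -/
  carrier : Type
  [addCommGroup : AddCommGroup carrier]
  [complexModule : Module ℂ carrier]
  [module : Module R carrier]
  [isScalarTower : IsScalarTower ℂ R carrier]
  /-- the four-point function -/
  toFun : W₀ → W₁ → W₂ → W₃ → carrier
  relations : ResidueRelations M₀ M₁ M₂ M₃ z₁ z₂ d toFun

attribute [instance] ResidueFunctional.addCommGroup ResidueFunctional.complexModule
  ResidueFunctional.module ResidueFunctional.isScalarTower

/-- The product of all four-point functions satisfying the residue relations. -/
def universalFunctional (w₀ : W₀) (w₁ : W₁) (w₂ : W₂) (w₃ : W₃) :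
    ∀ i : ResidueFunctional M₀ M₁ M₂ M₃ z₁ z₂ d, i.carrier :=
  fun i => i.toFun w₀ w₁ w₂ w₃

/-- The relations can be checked factor by factor: their coefficients and truncation bounds depend
only on the vectors, never on the functional. -/
lemma residueRelations_universalFunctional :
    ResidueRelations M₀ M₁ M₂ M₃ z₁ z₂ d (universalFunctional M₀ M₁ M₂ M₃ z₁ z₂ d) where
  linear₀ w₁ w₂ w₃ := ⟨fun _ _ => funext fun i => (i.relations.linear₀ w₁ w₂ w₃).map_add _ _,
    fun _ _ => funext fun i => (i.relations.linear₀ w₁ w₂ w₃).map_smul _ _⟩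
  linear₁ w₀ w₂ w₃ := ⟨fun _ _ => funext fun i => (i.relations.linear₁ w₀ w₂ w₃).map_add _ _,
    fun _ _ => funext fun i => (i.relations.linear₁ w₀ w₂ w₃).map_smul _ _⟩
  linear₂ w₀ w₁ w₃ := ⟨fun _ _ => funext fun i => (i.relations.linear₂ w₀ w₁ w₃).map_add _ _,
    fun _ _ => funext fun i => (i.relations.linear₂ w₀ w₁ w₃).map_smul _ _⟩
  linear₃ w₀ w₁ w₂ := ⟨fun _ _ => funext fun i => (i.relations.linear₃ w₀ w₁ w₂).map_add _ _,
    fun _ _ => funext fun i => (i.relations.linear₃ w₀ w₁ w₂).map_smul _ _⟩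
  pole₁ u w₀ w₁ w₂ w₃ N h₀ h₂ h₃ := funext fun i => by
    simpa only [universalFunctional, Pi.add_apply, Finset.sum_apply, Pi.smul_apply,
      Pi.zero_apply] using
      i.relations.pole₁ u w₀ w₁ w₂ w₃ N h₀ h₂ h₃
  pole₂ u w₀ w₁ w₂ w₃ N h₀ h₁ h₃ := funext fun i => by
    simpa only [universalFunctional, Pi.add_apply, Finset.sum_apply, Pi.smul_apply,
      Pi.zero_apply] using
      i.relations.pole₂ u w₀ w₁ w₂ w₃ N h₀ h₁ h₃
  pole_zero m u w₀ w₁ w₂ w₃ N h₁ h₂ := funext fun i => by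
    simpa only [universalFunctional, Pi.add_apply, Finset.sum_apply, Pi.smul_apply,
      Pi.zero_apply] using
      i.relations.pole_zero m u w₀ w₁ w₂ w₃ N h₁ h₂

/-- A sequence of vectors satisfies a monic relation that holds for all four-point functions. -/
theorem exists_uniform_monic_relation [IsNoetherianRing R]
    (h₀ : M₀.C₁Cofinite) (h₁ : M₁.C₁Cofinite) (h₂ : M₂.C₁Cofinite) (h₃ : M₃.C₁Cofinite)
    (w₀ : ℕ → W₀) (w₁ : ℕ → W₁) (w₂ : ℕ → W₂) (w₃ : ℕ → W₃) :
    ∃ (m : ℕ) (a : ℕ → R), 0 < m ∧ ∀ (S : Type) [AddCommGroup S] [Module ℂ S] [Module R S]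
      [IsScalarTower ℂ R S] (F : W₀ → W₁ → W₂ → W₃ → S),
      ResidueRelations M₀ M₁ M₂ M₃ z₁ z₂ d F →
      F (w₀ m) (w₁ m) (w₂ m) (w₃ m) + ∑ k ∈ Finset.Icc 1 m,
        a k • F (w₀ (m - k)) (w₁ (m - k)) (w₂ (m - k)) (w₃ (m - k)) = 0 := by
  obtain ⟨G, hG, hmem⟩ := (residueRelations_universalFunctional M₀ M₁ M₂ M₃ z₁ z₂
    d).exists_fg_forall_mem h₀ h₁ h₂ h₃
  obtain ⟨m, a, hm, h⟩ := hG.exists_monic_relation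
    (fun i => universalFunctional M₀ M₁ M₂ M₃ z₁ z₂ d (w₀ i) (w₁ i) (w₂ i) (w₃ i))
    (fun i => hmem _ _ _ _)
  refine ⟨m, a, hm, fun S _ _ _ _ F hF => ?_⟩
  -- The given functional is one of the factors.
  have := congrFun h ⟨S, F, hF⟩
  simpa only [universalFunctional, Pi.add_apply, Finset.sum_apply, Pi.smul_apply,
      Pi.zero_apply] using this

end ResidueRelations

/-! ### Consequences of the Jacobi identity -/

namespace IntertwiningOperator

variable {V W₁ W₂ W₃ : Type*} [AddCommGroup V] [Module ℂ V]
  [AddCommGroup W₁] [Module ℂ W₁] [AddCommGroup W₂] [Module ℂ W₂]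
  [AddCommGroup W₃] [Module ℂ W₃] {𝕍 : VertexOperatorAlgebra V}
  {Y₁ : Modes V W₁} {Y₂ : Modes V W₂} {Y₃ : Modes V W₃}

lemma exists_mode_add_eq_zero (I : IntertwiningOperator 𝕍 Y₁ Y₂ Y₃) (n : ℝ) (w₁ : W₁) (w₂ : W₂) :
    ∃ N : ℕ, ∀ i : ℕ, N ≤ i → I.mode (n + i) w₁ w₂ = 0 := by
  obtain ⟨B, hB⟩ := I.truncation w₁ w₂
  obtain ⟨N, hN⟩ := exists_nat_ge (B - n)
  refine ⟨N, fun i hi => hB _ ?_⟩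
  have : (N : ℝ) ≤ i := by exact_mod_cast hi
  linarith

/-- The commutator formula. -/
lemma commutator (I : IntertwiningOperator 𝕍 Y₁ Y₂ Y₃) (u : V) (w₁ : W₁) (w₂ : W₂) (m : ℤ) (n : ℝ)
    {N : ℕ} (hN : ∀ i : ℕ, N ≤ i → Y₁ i u w₁ = 0) :
    Y₃ m u (I.mode n w₁ w₂) = I.mode n w₁ (Y₂ m u w₂)
      + ∑ i ∈ Finset.range N, ((Ring.choose m i : ℤ) : ℂ) • I.mode (n + m - i) (Y₁ i u w₁) w₂ := by
  -- With l = 0 only i = 0 survives in the two sums on the left.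
  have h := I.jacobi u w₁ w₂ 0 m n
  rw [finsum_eq_single _ 0, finsum_eq_single _ 0,
    finsum_eq_sum_of_support_subset (s := Finset.range N)] at h
  · simp only [pow_zero, Ring.choose_zero_right, Int.cast_one, mul_one, Nat.cast_zero,
      add_zero, sub_zero, one_smul, Int.cast_zero, zero_add, zpow_zero] at h
    rw [sub_eq_iff_eq_add'] at h
    rw [h]
    simp only [add_comm (m : ℝ) n]
  · intro i hi
    by_contra hi'
    apply hi
    simp [hN i (by simpa using hi')]
  · intro i hi
    simp [Ring.choose_zero_pos ℤ (Nat.pos_of_ne_zero hi)]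
  · intro i hi
    simp [Ring.choose_zero_pos ℤ (Nat.pos_of_ne_zero hi)]

/-- The iterate formula. -/
lemma iterate (I : IntertwiningOperator 𝕍 Y₁ Y₂ Y₃) (u : V) (w₁ : W₁) (w₂ : W₂) (l : ℤ) (n : ℝ)
    {N N' : ℕ} (hN : ∀ i : ℕ, N ≤ i → I.mode (n + i) w₁ w₂ = 0)
    (hN' : ∀ i : ℕ, N' ≤ i → Y₂ i u w₂ = 0) :
    I.mode n (Y₁ l u w₁) w₂
      = ∑ i ∈ Finset.range N, ((-1 : ℂ) ^ i * ((Ring.choose l i : ℤ) : ℂ)) •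
          Y₃ (l - i) u (I.mode (n + i) w₁ w₂)
        - ∑ i ∈ Finset.range N', ((-1 : ℂ) ^ ((i : ℤ) + l) * ((Ring.choose l i : ℤ) : ℂ)) •
          I.mode (n + l - i) w₁ (Y₂ i u w₂) := by
  -- With m = 0 only i = 0 survives on the right.
  have h := I.jacobi u w₁ w₂ l 0 n
  rw [finsum_eq_sum_of_support_subset (s := Finset.range N),
    finsum_eq_sum_of_support_subset (s := Finset.range N'), finsum_eq_single _ 0] at h
  · simp only [zero_add, Nat.cast_zero, Ring.choose_zero_right, Int.cast_one, one_smul,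
      Int.cast_zero, sub_zero, add_zero] at h
    exact h.symm
  · intro i hi
    simp [Ring.choose_zero_pos ℤ (Nat.pos_of_ne_zero hi)]
  · intro i hi
    by_contra hi'
    apply hi
    simp [hN' i (by simpa using hi')]
  · intro i hi
    by_contra hi'
    apply hi
    simp [hN i (by simpa using hi')]

lemma commutator_zero (I : IntertwiningOperator 𝕍 Y₁ Y₂ Y₃) (u : V) (w₁ : W₁) (w₂ : W₂) (n : ℝ) :
    Y₃ 0 u (I.mode n w₁ w₂) = I.mode n w₁ (Y₂ 0 u w₂) + I.mode n (Y₁ 0 u w₁) w₂ := by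
  have h := I.jacobi u w₁ w₂ 0 0 n
  rw [finsum_eq_single _ 0, finsum_eq_single _ 0, finsum_eq_single _ 0] at h
  · simp only [pow_zero, Ring.choose_zero_right, Int.cast_one, mul_one, Nat.cast_zero,
      add_zero, sub_zero, one_smul, Int.cast_zero, zero_add, zpow_zero] at h
    rw [sub_eq_iff_eq_add'] at h
    exact h
  all_goals
    intro i hi
    simp [Ring.choose_zero_pos ℤ (Nat.pos_of_ne_zero hi)]

variable {W₀ : Type*} [AddCommGroup W₀] [Module ℂ W₀] {M₀ : DiscreteModule 𝕍 W₀}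

/-- The iterate formula for an intertwining operator with values in a contragredient module. -/
lemma iterate_contragredient (I : IntertwiningOperator 𝕍 Y₁ Y₂ M₀.contragredient) (u : V)
    (w₀ : W₀) (w₁ : W₁) (w₂ : W₂) (l : ℤ) (n : ℝ)
    {N N' : ℕ} (hN : ∀ i : ℕ, N ≤ i → M₀.adjointMode (l - i) u w₀ = 0)
    (hN' : ∀ i : ℕ, N' ≤ i → Y₂ i u w₂ = 0) :
    (I.mode n (Y₁ l u w₁) w₂).1 w₀
      = ∑ i ∈ Finset.range N, ((-1 : ℂ) ^ i * ((Ring.choose l i : ℤ) : ℂ)) *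
          (I.mode (n + i) w₁ w₂).1 (M₀.adjointMode (l - i) u w₀)
        - ∑ i ∈ Finset.range N', ((-1 : ℂ) ^ ((i : ℤ) + l) * ((Ring.choose l i : ℤ) : ℂ)) *
          (I.mode (n + l - i) w₁ (Y₂ i u w₂)).1 w₀ := by
  -- The iterate formula needs truncation of the intertwining operator. After pairing with `w₀` the
  -- vanishing of the adjoint modes cuts the sum back to `N`.
  obtain ⟨N'', hN''⟩ := I.exists_mode_add_eq_zero n w₁ w₂
  rw [I.iterate u w₁ w₂ l n (N := max N N'') (fun i hi => hN'' i ((le_max_right _ _).trans hi)) hN']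
  simp only [AddSubgroupClass.coe_sub, AddSubmonoidClass.coe_finsetSum, SetLike.val_smul,
    LinearMap.sub_apply, LinearMap.sum_apply, LinearMap.smul_apply, smul_eq_mul]
  congr 1
  symm
  apply Finset.sum_subset (Finset.range_mono (le_max_left _ _))
  intro i _ hi
  rw [hN i (by simpa using hi), map_zero, mul_zero]

lemma commutator_contragredient (I : IntertwiningOperator 𝕍 Y₁ Y₂ M₀.contragredient) (u : V)
    (w₀ : W₀) (w₁ : W₁) (w₂ : W₂) (m : ℤ) (n : ℝ)
    {N : ℕ} (hN : ∀ i : ℕ, N ≤ i → Y₁ i u w₁ = 0) :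
    (I.mode n w₁ w₂).1 (M₀.adjointMode m u w₀) = (I.mode n w₁ (Y₂ m u w₂)).1 w₀
      + ∑ i ∈ Finset.range N, ((Ring.choose m i : ℤ) : ℂ) *
        (I.mode (n + m - i) (Y₁ i u w₁) w₂).1 w₀ := by
  change (M₀.contragredient m u (I.mode n w₁ w₂)).1 w₀ = _
  have := congrArg (fun f => f.1 w₀) (I.commutator u w₁ w₂ m n hN)
  simpa only [AddMemClass.coe_add, AddSubmonoidClass.coe_finsetSum, SetLike.val_smul,
    LinearMap.add_apply, LinearMap.sum_apply, LinearMap.smul_apply, smul_eq_mul] using this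

end IntertwiningOperator

/-! ### Sums and binomial coefficients -/

lemma finsum_eq_sum_range {M : Type*} [AddCommMonoid M] {f : ℕ → M} {N : ℕ}
    (h : ∀ i, N ≤ i → f i = 0) : ∑ᶠ i, f i = ∑ i ∈ Finset.range N, f i := by
  refine finsum_eq_sum_of_support_subset _ fun i hi => ?_
  by_contra hi'
  exact hi (h i (by simpa using hi'))

/-- Used for i = j + q in sums weighted by binomial coefficients (i choose j), which vanish for i <
j. -/
lemma finsum_add_left_eq_sum_range {M : Type*} [AddCommMonoid M] {f : ℕ → M} {j N : ℕ}
    (hj : ∀ i < j, f i = 0) (hN : ∀ i, N ≤ i → f i = 0) :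
    ∑ᶠ q, f (j + q) = ∑ i ∈ Finset.range N, f i := by
  have hsupp : ∀ x ∈ Function.support f, x ∈ Set.range (fun q : ℕ => j + q) ↔ x ∈ Set.univ := by
    intro x hx
    simp only [Set.mem_range, Set.mem_univ, iff_true]
    refine ⟨x - j, Nat.add_sub_cancel' ?_⟩
    by_contra hlt
    exact hx (hj x (not_le.1 hlt))
  rw [← finsum_eq_sum_range hN, ← finsum_mem_univ f,
    ← finsum_mem_inter_support_eq' f _ Set.univ hsupp, finsum_mem_range (add_right_injective j)]

lemma choose_neg_one_sub (j q : ℕ) :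
    Ring.choose (-1 - j : ℤ) q = (-1) ^ q * ((j + q).choose q : ℕ) := by
  rw [show (-1 - j : ℤ) = -(j + 1 : ℕ) by push_cast; ring, Ring.choose_neg,
    show (((j + 1 : ℕ) : ℤ) + q - 1) = ((j + q : ℕ) : ℤ) by push_cast; ring,
    Ring.choose_natCast, Units.smul_def, Int.coe_negOnePow_natCast]
  rfl

lemma neg_one_pow_mul_choose_neg_one (i : ℕ) :
    (-1 : ℂ) ^ i * ((Ring.choose (-1 : ℤ) i : ℤ) : ℂ) = 1 := by
  have := choose_neg_one_sub 0 i
  simp only [Nat.cast_zero, sub_zero, zero_add, Nat.choose_self, Nat.cast_one, mul_one] at this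
  rw [this]
  push_cast
  rw [← mul_pow]
  simp

lemma neg_one_zpow_mul_choose_neg_one (i : ℕ) :
    (-1 : ℂ) ^ ((i : ℤ) + -1) * ((Ring.choose (-1 : ℤ) i : ℤ) : ℂ) = -1 := by
  rw [zpow_add₀ (by norm_num), zpow_natCast, mul_right_comm, neg_one_pow_mul_choose_neg_one]
  norm_num

lemma neg_zpow_smul {A S : Type*} [CommRing A] [AddCommGroup S] [Module A S] (d : Aˣ) (i : ℕ)
    (x : S) : (((-d) ^ (-1 - i : ℤ) : Aˣ) : A) • x
      = (-1 : ℤ) ^ (i + 1) • ((d ^ (-1 - i : ℤ) : Aˣ) : A) • x := by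
  rcases Nat.even_or_odd i with h | h
  · have h' : Odd (-1 - i : ℤ) := by
      rw [show (-1 - i : ℤ) = -((i + 1 : ℕ) : ℤ) by push_cast; ring, odd_neg, Int.odd_coe_nat]
      exact h.add_one
    rw [h'.neg_zpow, h.add_one.neg_one_pow, Units.val_neg, neg_smul, neg_one_smul]
  · have h' : Even (-1 - i : ℤ) := by
      rw [show (-1 - i : ℤ) = -((i + 1 : ℕ) : ℤ) by push_cast; ring, even_neg, Int.even_coe_nat]
      exact h.add_one
    rw [h'.neg_zpow, h.add_one.neg_one_pow, one_smul]

/-- Both sides equal the symmetric binomial coefficient (j + q choose j). -/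
lemma choose_neg_one_sub_comm (j q : ℕ) :
    (-1) ^ q * Ring.choose (-1 - j : ℤ) q = (-1) ^ j * Ring.choose (-1 - q : ℤ) j := by
  rw [choose_neg_one_sub, choose_neg_one_sub, ← mul_assoc, ← mul_assoc, ← mul_pow, ← mul_pow,
    add_comm q j, Nat.choose_symm_add]
  simp

lemma choose_mul_choose_add (m : ℤ) (j q : ℕ) :
    Ring.choose m (j + q) * Ring.choose ((j + q : ℕ) : ℤ) j
      = Ring.choose m j * Ring.choose (m - j) q := by
  have := Ring.choose_smul_choose m (Nat.le_add_right j q)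
  rw [Nat.add_sub_cancel_left] at this
  rw [← this, Ring.choose_natCast, nsmul_eq_mul, mul_comm]

namespace TwoVariableSeries

lemma sum_boundedBelow_apply {ι : Type*} (A : Finset ι) (φ : ι → boundedBelow) (r s : ℝ) :
    (∑ i ∈ A, φ i).1 r s = ∑ i ∈ A, (φ i).1 r s := by
  rw [AddSubmonoidClass.coe_finsetSum, Finset.sum_apply, Finset.sum_apply]

lemma zsmul_boundedBelow_apply (n : ℤ) (φ : boundedBelow) (r s : ℝ) :
    (n • φ).1 r s = n * φ.1 r s := by
  rw [← zsmul_eq_mul]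
  rfl

lemma add_boundedBelow_apply (φ ψ : boundedBelow) (r s : ℝ) :
    (φ + ψ).1 r s = φ.1 r s + ψ.1 r s := rfl

end TwoVariableSeries

/-! ### Products of intertwining operators -/

section Product

open TwoVariableSeries ExpansionRing

variable {V W₀ W₁ W₂ W₃ W : Type*} [AddCommGroup V] [Module ℂ V]
  [AddCommGroup W₀] [Module ℂ W₀] [AddCommGroup W₁] [Module ℂ W₁]
  [AddCommGroup W₂] [Module ℂ W₂] [AddCommGroup W₃] [Module ℂ W₃]
  [AddCommGroup W] [Module ℂ W] {𝕍 : VertexOperatorAlgebra V}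
  {M₀ : DiscreteModule 𝕍 W₀} {M₁ : DiscreteModule 𝕍 W₁} {M₂ : DiscreteModule 𝕍 W₂}
  {M₃ : DiscreteModule 𝕍 W₃} {M : DiscreteModule 𝕍 W}

/-- The product series as an element of `boundedBelow`. -/
noncomputable def productFunctional
    (𝓨 : IntertwiningOperator 𝕍 M₁.Y M.Y M₀.contragredient)
    (𝓩 : IntertwiningOperator 𝕍 M₂.Y M₃.Y M.Y)
    (w₀ : W₀) (w₁ : W₁) (w₂ : W₂) (w₃ : W₃) : boundedBelow :=
  ⟨productSeries 𝓨 𝓩 w₀ w₁ w₂ w₃, by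
    obtain ⟨N, hN⟩ := 𝓩.truncation w₂ w₃
    refine ⟨-1 - N, fun r s hs => ?_⟩
    rw [productSeries, hN _ (by linarith)]
    simp⟩

variable (𝓨 : IntertwiningOperator 𝕍 M₁.Y M.Y M₀.contragredient)
    (𝓩 : IntertwiningOperator 𝕍 M₂.Y M₃.Y M.Y)

lemma productFunctional_apply (w₀ : W₀) (w₁ : W₁) (w₂ : W₂) (w₃ : W₃) (r s : ℝ) :
    (productFunctional 𝓨 𝓩 w₀ w₁ w₂ w₃).1 r s
      = (𝓨.mode (-r - 1) w₁ (𝓩.mode (-s - 1) w₂ w₃)).1 w₀ := rfl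

/-- The iterate formula for the outer operator sends u to infinity or, with modes u_i, i ≥ 0, onto
the inner product 𝓩(w₂, y) w₃. The commutator formula distributes u_i over `w₂` and `w₃`, and the
terms with u_j w₂ add up to (t - y)^(-1-j). -/
lemma productFunctional_pole₁ (u : V) (w₀ : W₀) (w₁ : W₁) (w₂ : W₂) (w₃ : W₃) (N : ℕ)
    (h₀ : ∀ i : ℕ, N ≤ i → M₀.adjointMode (-1 - i) u w₀ = 0)
    (h₂ : ∀ i : ℕ, N ≤ i → M₂.Y i u w₂ = 0) (h₃ : ∀ i : ℕ, N ≤ i → M₃.Y i u w₃ = 0) :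
    productFunctional 𝓨 𝓩 w₀ (M₁.Y (-1) u w₁) w₂ w₃
      = ∑ i ∈ Finset.range N, ((tUnit ^ (i : ℤ) : ExpansionRingˣ) : ExpansionRing) •
          productFunctional 𝓨 𝓩 (M₀.adjointMode (-1 - i) u w₀) w₁ w₂ w₃
        + ∑ i ∈ Finset.range N, ((tAddUnit (-1) ^ (-1 - i : ℤ) : ExpansionRingˣ) : ExpansionRing) •
          productFunctional 𝓨 𝓩 w₀ w₁ (M₂.Y i u w₂) w₃
        + ∑ i ∈ Finset.range N, ((tUnit ^ (-1 - i : ℤ) : ExpansionRingˣ) : ExpansionRing) •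
          productFunctional 𝓨 𝓩 w₀ w₁ w₂ (M₃.Y i u w₃) := by
  ext r s
  simp only [add_boundedBelow_apply, sum_boundedBelow_apply, tUnit_zpow_smul_apply,
    tAddUnit_zpow_smul_apply, productFunctional_apply]
  set v := 𝓩.mode (-s - 1) w₂ w₃ with hv
  obtain ⟨N₁, hN₁⟩ := exists_nat_forall_eq_zero (M.truncation u v)
  have hev : ∀ᶠ n : ℕ in Filter.atTop, ∀ j ∈ Finset.range N, ∀ i : ℕ, n ≤ i →
      𝓩.mode (-s - 1 - j + i) (M₂.Y j u w₂) w₃ = 0 := by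
    rw [Filter.eventually_all_finset]
    intro j _
    obtain ⟨n, hn⟩ := 𝓩.exists_mode_add_eq_zero (-s - 1 - j) (M₂.Y j u w₂) w₃
    filter_upwards [Filter.eventually_ge_atTop n] with n' hn' i hi using hn i (hn'.trans hi)
  -- One cutoff beyond which all the sums in play have stopped.
  obtain ⟨N', hN', hN'N, hN'N₁⟩ := (hev.and ((Filter.eventually_ge_atTop N).and
    (Filter.eventually_ge_atTop N₁))).exists
  rw [𝓨.iterate_contragredient u w₀ w₁ v (-1) (-r - 1) h₀
    (N' := N') (fun i hi => hN₁ i (hN'N₁.trans hi))]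
  simp only [neg_one_pow_mul_choose_neg_one, neg_one_zpow_mul_choose_neg_one, one_mul, neg_one_mul, Finset.sum_neg_distrib, sub_neg_eq_add]
  rw [add_assoc]
  congr 1
  · refine Finset.sum_congr rfl fun i _ => ?_
    rw [show -r - 1 + (i : ℝ) = -(r - ((i : ℤ) : ℝ)) - 1 by push_cast; ring]
  have hterm : ∀ i ∈ Finset.range N', (𝓨.mode (-r - 1 + ((-1 : ℤ) : ℝ) - i) w₁ (M.Y i u v)).1 w₀
      = (𝓨.mode (-(r - ((-1 - i : ℤ) : ℝ)) - 1) w₁ (𝓩.mode (-s - 1) w₂ (M₃.Y i u w₃))).1 w₀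
        + ∑ j ∈ Finset.range N, ((Ring.choose (i : ℤ) j : ℤ) : ℂ) *
          (𝓨.mode (-(r + 1 + i) - 1) w₁ (𝓩.mode (-(s - (i - j)) - 1) (M₂.Y j u w₂) w₃)).1 w₀ := by
    intro i _
    rw [hv, 𝓩.commutator u w₂ w₃ i (-s - 1) h₂]
    simp only [map_add, map_sum, map_smul, AddMemClass.coe_add, AddSubmonoidClass.coe_finsetSum,
      SetLike.val_smul, LinearMap.add_apply, LinearMap.sum_apply, LinearMap.smul_apply,
      smul_eq_mul]
    rw [show -r - 1 + ((-1 : ℤ) : ℝ) - i = -(r + 1 + i) - 1 by push_cast; ring,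
      show -(r - ((-1 - i : ℤ) : ℝ)) - 1 = -(r + 1 + i) - 1 by push_cast; ring]
    congr 1
    refine Finset.sum_congr rfl fun j _ => ?_
    rw [show -s - 1 + ((i : ℤ) : ℝ) - j = -(s - (i - j)) - 1 by push_cast; ring]
  rw [Finset.sum_congr rfl hterm, Finset.sum_add_distrib, add_comm]
  congr 1
  · rw [Finset.sum_comm]
    refine Finset.sum_congr rfl fun j hj => ?_
    rw [← finsum_add_left_eq_sum_range (j := j)]
    · refine finsum_congr fun q => ?_
      -- The coefficient of t^(-1-j-q) y^q in (t - y)^(-1-j).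
      have hcoef : ((Ring.choose ((j + q : ℕ) : ℤ) j : ℤ) : ℂ)
          = ((Ring.choose (-1 - j : ℤ) q : ℤ) : ℂ) * (-1) ^ q := by
        rw [choose_neg_one_sub, Ring.choose_natCast, Nat.choose_symm_add]
        push_cast
        rw [mul_right_comm, ← mul_pow]
        simp
      rw [hcoef, show -(r + 1 + ((j + q : ℕ) : ℝ)) - 1 = -(r - ((-1 - j : ℤ) : ℝ) + q) - 1 by
          push_cast; ring,
        show -(s - (((j + q : ℕ) : ℝ) - j)) - 1 = -(s - q) - 1 by push_cast; ring]
    · intro i hi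
      rw [Ring.choose_natCast, Nat.choose_eq_zero_of_lt hi]
      simp
    · intro i hi
      rw [show -(s - ((i : ℝ) - j)) - 1 = -s - 1 - j + i by ring, hN' j hj i hi]
      simp
  · symm
    apply Finset.sum_subset (Finset.range_mono hN'N)
    intro i _ hi
    rw [h₃ i (by simpa using hi)]
    simp

/-- Here the iterate formula is applied to the inner operator. The resulting modes u_{-1-i} commute
past the outer one to infinity, leaving terms u_j w₁ that add up to (y - t)^(-1-j), expanded in |t|
> |y|. -/
lemma productFunctional_pole₂ (u : V) (w₀ : W₀) (w₁ : W₁) (w₂ : W₂) (w₃ : W₃) (N : ℕ)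
    (h₀ : ∀ i : ℕ, N ≤ i → M₀.adjointMode (-1 - i) u w₀ = 0)
    (h₁ : ∀ i : ℕ, N ≤ i → M₁.Y i u w₁ = 0) (h₃ : ∀ i : ℕ, N ≤ i → M₃.Y i u w₃ = 0) :
    productFunctional 𝓨 𝓩 w₀ w₁ (M₂.Y (-1) u w₂) w₃
      = ∑ i ∈ Finset.range N, ((yUnit ^ (i : ℤ) : ExpansionRingˣ) : ExpansionRing) •
          productFunctional 𝓨 𝓩 (M₀.adjointMode (-1 - i) u w₀) w₁ w₂ w₃
        + ∑ i ∈ Finset.range N,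
          (((-tAddUnit (-1)) ^ (-1 - i : ℤ) : ExpansionRingˣ) : ExpansionRing) •
          productFunctional 𝓨 𝓩 w₀ (M₁.Y i u w₁) w₂ w₃
        + ∑ i ∈ Finset.range N, ((yUnit ^ (-1 - i : ℤ) : ExpansionRingˣ) : ExpansionRing) •
          productFunctional 𝓨 𝓩 w₀ w₁ w₂ (M₃.Y i u w₃) := by
  have hneg : ∀ (i : ℕ) (φ : boundedBelow),
      (((-tAddUnit (-1)) ^ (-1 - i : ℤ) : ExpansionRingˣ) : ExpansionRing) • φ
        = (-1 : ℤ) ^ (i + 1) • ((tAddUnit (-1) ^ (-1 - i : ℤ) : ExpansionRingˣ) : ExpansionRing) • φ :=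
    fun i φ => neg_zpow_smul _ i φ
  ext r s
  simp only [hneg, add_boundedBelow_apply, sum_boundedBelow_apply, yUnit_zpow_smul_apply,
    tAddUnit_zpow_smul_apply, productFunctional_apply, zsmul_boundedBelow_apply]
  obtain ⟨N₁, hN₁⟩ := 𝓩.exists_mode_add_eq_zero (-s - 1) w₂ w₃
  have hv : ∀ i : ℕ, max N N₁ ≤ i → 𝓩.mode (-s - 1 + i) w₂ w₃ = 0 :=
    fun i hi => hN₁ i ((le_max_right _ _).trans hi)
  rw [𝓩.iterate u w₂ w₃ (-1) (-s - 1) hv h₃]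
  simp only [neg_one_pow_mul_choose_neg_one, neg_one_zpow_mul_choose_neg_one, one_smul,
    neg_one_smul, Finset.sum_neg_distrib, sub_neg_eq_add, map_add, map_sum, AddMemClass.coe_add,
    AddSubmonoidClass.coe_finsetSum, LinearMap.add_apply, LinearMap.sum_apply]
  congr 1
  · have hterm : ∀ i ∈ Finset.range (max N N₁),
        (𝓨.mode (-r - 1) w₁ (M.Y (-1 - i) u (𝓩.mode (-s - 1 + i) w₂ w₃))).1 w₀
        = (𝓨.mode (-r - 1) w₁ (𝓩.mode (-s - 1 + i) w₂ w₃)).1 (M₀.adjointMode (-1 - i) u w₀)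
          - ∑ j ∈ Finset.range N, ((Ring.choose (-1 - i : ℤ) j : ℤ) : ℂ) *
            (𝓨.mode (-r - 1 + (-1 - i : ℤ) - j) (M₁.Y j u w₁)
              (𝓩.mode (-s - 1 + i) w₂ w₃)).1 w₀ := by
      intro i _
      rw [𝓨.commutator_contragredient u w₀ w₁ _ (-1 - i) (-r - 1) h₁, add_sub_cancel_right]
    rw [Finset.sum_congr rfl hterm, Finset.sum_sub_distrib, sub_eq_add_neg]
    congr 1
    · symm
      rw [Finset.sum_congr rfl fun (i : ℕ) _ => by
        rw [show -(s - ((i : ℤ) : ℝ)) - 1 = -s - 1 + i by push_cast; ring]]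
      apply Finset.sum_subset (Finset.range_mono (le_max_left _ _))
      intro i _ hi
      rw [h₀ i (by simpa using hi), map_zero]
    · rw [Finset.sum_comm, ← Finset.sum_neg_distrib]
      refine Finset.sum_congr rfl fun j _ => ?_
      rw [finsum_eq_sum_range (N := max N N₁), ← Finset.sum_neg_distrib, Finset.mul_sum]
      · refine Finset.sum_congr rfl fun q _ => ?_
        have hcoef : -((Ring.choose (-1 - q : ℤ) j : ℤ) : ℂ) = (((-1) ^ (j + 1) : ℤ) : ℂ) *
            (((Ring.choose (-1 - j : ℤ) q : ℤ) : ℂ) * (-1) ^ q) := by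
          have := congrArg (Int.cast : ℤ → ℂ) (choose_neg_one_sub_comm j q)
          push_cast at this
          have h1 : ((-1 : ℂ) ^ j) * (-1) ^ j = 1 := by rw [← mul_pow]; simp
          push_cast
          rw [mul_comm _ ((-1 : ℂ) ^ q), this, pow_succ]
          linear_combination ((Ring.choose (-1 - q : ℤ) j : ℤ) : ℂ) * h1
        rw [← neg_mul, hcoef, mul_assoc ((((-1) ^ (j + 1) : ℤ)) : ℂ),
          show -r - 1 + ((-1 - q : ℤ) : ℝ) - j = -(r - ((-1 - j : ℤ) : ℝ) + q) - 1 by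
            push_cast; ring,
          show -s - 1 + (q : ℝ) = -(s - q) - 1 by ring]
      · intro i hi
        rw [show -(s - (i : ℝ)) - 1 = -s - 1 + i by ring, hv i hi]
        simp
  · refine Finset.sum_congr rfl fun i _ => ?_
    rw [show -(s - ((-1 - i : ℤ) : ℝ)) - 1 = -s - 1 + ((-1 : ℤ) : ℝ) - i by push_cast; ring]

/-- The commutator formula, applied to the outer and then to the inner operator. -/
lemma productFunctional_pole_zero (m : ℤ) (u : V) (w₀ : W₀) (w₁ : W₁) (w₂ : W₂) (w₃ : W₃) (N : ℕ)
    (h₁ : ∀ i : ℕ, N ≤ i → M₁.Y i u w₁ = 0) (h₂ : ∀ i : ℕ, N ≤ i → M₂.Y i u w₂ = 0) :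
    productFunctional 𝓨 𝓩 (M₀.adjointMode m u w₀) w₁ w₂ w₃
      = ∑ i ∈ Finset.range N,
          Ring.choose m i • ((tUnit ^ (m - i : ℤ) : ExpansionRingˣ) : ExpansionRing) •
            productFunctional 𝓨 𝓩 w₀ (M₁.Y i u w₁) w₂ w₃
        + ∑ i ∈ Finset.range N,
          Ring.choose m i • ((yUnit ^ (m - i : ℤ) : ExpansionRingˣ) : ExpansionRing) •
            productFunctional 𝓨 𝓩 w₀ w₁ (M₂.Y i u w₂) w₃
        + productFunctional 𝓨 𝓩 w₀ w₁ w₂ (M₃.Y m u w₃) := by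
  ext r s
  simp only [add_boundedBelow_apply, sum_boundedBelow_apply, yUnit_zpow_smul_apply,
    tUnit_zpow_smul_apply, productFunctional_apply, zsmul_boundedBelow_apply]
  rw [𝓨.commutator_contragredient u w₀ w₁ _ m (-r - 1) h₁,
    𝓩.commutator u w₂ w₃ m (-s - 1) h₂]
  simp only [map_add, map_sum, map_smul, AddMemClass.coe_add, AddSubmonoidClass.coe_finsetSum,
      SetLike.val_smul, LinearMap.add_apply, LinearMap.sum_apply, LinearMap.smul_apply,
      smul_eq_mul]
  rw [add_comm, add_comm (DFunLike.coe _ _), ← add_assoc]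
  congr 2
  · refine Finset.sum_congr rfl fun i _ => ?_
    rw [show -(r - ((m - i : ℤ) : ℝ)) - 1 = -r - 1 + (m : ℝ) - i by push_cast; ring]
  · refine Finset.sum_congr rfl fun i _ => ?_
    rw [show -(s - ((m - i : ℤ) : ℝ)) - 1 = -s - 1 + (m : ℝ) - i by push_cast; ring]

theorem residueRelations_productFunctional :
    ResidueRelations M₀ M₁ M₂ M₃ tUnit yUnit (tAddUnit (-1)) (productFunctional 𝓨 𝓩) where
  linear₀ _ _ _ := ⟨fun _ _ => by ext r s; simp [productFunctional, productSeries],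
    fun _ _ => by ext r s; simp [productFunctional, productSeries]⟩
  linear₁ _ _ _ := ⟨fun _ _ => by ext r s; simp [productFunctional, productSeries],
    fun _ _ => by ext r s; simp [productFunctional, productSeries]⟩
  linear₂ _ _ _ := ⟨fun _ _ => by ext r s; simp [productFunctional, productSeries],
    fun _ _ => by ext r s; simp [productFunctional, productSeries]⟩
  linear₃ _ _ _ := ⟨fun _ _ => by ext r s; simp [productFunctional, productSeries],
    fun _ _ => by ext r s; simp [productFunctional, productSeries]⟩
  pole₁ := productFunctional_pole₁ 𝓨 𝓩
  pole₂ := productFunctional_pole₂ 𝓨 𝓩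
  pole_zero := productFunctional_pole_zero 𝓨 𝓩

lemma dt_productFunctional (w₀ : W₀) (w₁ : W₁) (w₂ : W₂) (w₃ : W₃) :
    dt (productFunctional 𝓨 𝓩 w₀ w₁ w₂ w₃).1
      = (productFunctional 𝓨 𝓩 w₀ (M₁.Y 0 𝕍.omega w₁) w₂ w₃).1 := by
  funext r s
  rw [productFunctional_apply, 𝓨.derivative, dt, productFunctional_apply,
    show -(r + 1) - 1 = -r - 1 - 1 by ring]
  simp only [SetLike.val_smul, LinearMap.smul_apply, smul_eq_mul]
  congr 1
  push_cast
  ring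

lemma dy_productFunctional (w₀ : W₀) (w₁ : W₁) (w₂ : W₂) (w₃ : W₃) :
    dy (productFunctional 𝓨 𝓩 w₀ w₁ w₂ w₃).1
      = (productFunctional 𝓨 𝓩 w₀ w₁ (M₂.Y 0 𝕍.omega w₂) w₃).1 := by
  funext r s
  rw [productFunctional_apply, 𝓩.derivative, dy, productFunctional_apply,
    show -(s + 1) - 1 = -s - 1 - 1 by ring]
  simp only [map_smul, SetLike.val_smul, LinearMap.smul_apply, smul_eq_mul]
  congr 1
  push_cast
  ring

end Product

/-! ### Iterates of intertwining operators -/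

section Iterate

open TwoVariableSeries ExpansionRing

variable {V W₀ W₁ W₂ W₃ W : Type*} [AddCommGroup V] [Module ℂ V]
  [AddCommGroup W₀] [Module ℂ W₀] [AddCommGroup W₁] [Module ℂ W₁]
  [AddCommGroup W₂] [Module ℂ W₂] [AddCommGroup W₃] [Module ℂ W₃]
  [AddCommGroup W] [Module ℂ W] {𝕍 : VertexOperatorAlgebra V}
  {M₀ : DiscreteModule 𝕍 W₀} {M₁ : DiscreteModule 𝕍 W₁} {M₂ : DiscreteModule 𝕍 W₂}
  {M₃ : DiscreteModule 𝕍 W₃} {M : DiscreteModule 𝕍 W}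

/-- The iterate series as an element of `boundedBelow`. -/
noncomputable def iterateFunctional
    (𝓩 : IntertwiningOperator 𝕍 M₁.Y M₂.Y M.Y)
    (𝓨 : IntertwiningOperator 𝕍 M.Y M₃.Y M₀.contragredient)
    (w₀ : W₀) (w₁ : W₁) (w₂ : W₂) (w₃ : W₃) : boundedBelow :=
  ⟨iterateSeries 𝓩 𝓨 w₀ w₁ w₂ w₃, by
    obtain ⟨N, hN⟩ := 𝓩.truncation w₁ w₂
    refine ⟨-1 - N, fun r s hs => ?_⟩
    rw [iterateSeries, hN _ (by linarith)]
    simp⟩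

variable (𝓩 : IntertwiningOperator 𝕍 M₁.Y M₂.Y M.Y)
    (𝓨 : IntertwiningOperator 𝕍 M.Y M₃.Y M₀.contragredient)

lemma iterateFunctional_apply (w₀ : W₀) (w₁ : W₁) (w₂ : W₂) (w₃ : W₃) (r s : ℝ) :
    (iterateFunctional 𝓩 𝓨 w₀ w₁ w₂ w₃).1 r s
      = (𝓨.mode (-r - 1) (𝓩.mode (-s - 1) w₁ w₂) w₃).1 w₀ := rfl

/-- Two iterate formulas: the inner one moves u to `w₂` or to modes u_{-1-i} on the intermediate
vector, the outer one moves these to infinity and to `w₃`. The sums over i rebuild the powers of z₁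
= t + y. -/
lemma iterateFunctional_pole₁ (u : V) (w₀ : W₀) (w₁ : W₁) (w₂ : W₂) (w₃ : W₃) (N : ℕ)
    (h₀ : ∀ i : ℕ, N ≤ i → M₀.adjointMode (-1 - i) u w₀ = 0)
    (h₂ : ∀ i : ℕ, N ≤ i → M₂.Y i u w₂ = 0) (h₃ : ∀ i : ℕ, N ≤ i → M₃.Y i u w₃ = 0) :
    iterateFunctional 𝓩 𝓨 w₀ (M₁.Y (-1) u w₁) w₂ w₃
      = ∑ i ∈ Finset.range N, ((tAddUnit 1 ^ (i : ℤ) : ExpansionRingˣ) : ExpansionRing) •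
          iterateFunctional 𝓩 𝓨 (M₀.adjointMode (-1 - i) u w₀) w₁ w₂ w₃
        + ∑ i ∈ Finset.range N, ((yUnit ^ (-1 - i : ℤ) : ExpansionRingˣ) : ExpansionRing) •
          iterateFunctional 𝓩 𝓨 w₀ w₁ (M₂.Y i u w₂) w₃
        + ∑ i ∈ Finset.range N, ((tAddUnit 1 ^ (-1 - i : ℤ) : ExpansionRingˣ) : ExpansionRing) •
          iterateFunctional 𝓩 𝓨 w₀ w₁ w₂ (M₃.Y i u w₃) := by
  ext r s
  simp only [add_boundedBelow_apply, sum_boundedBelow_apply, yUnit_zpow_smul_apply,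
    tAddUnit_zpow_smul_apply, iterateFunctional_apply, one_pow, mul_one]
  obtain ⟨N', hN'⟩ := 𝓩.exists_mode_add_eq_zero (-s - 1) w₁ w₂
  rw [𝓩.iterate u w₁ w₂ (-1) (-s - 1) hN' h₂]
  simp only [neg_one_pow_mul_choose_neg_one, neg_one_zpow_mul_choose_neg_one, one_smul,
    neg_one_smul, Finset.sum_neg_distrib, sub_neg_eq_add, map_add, map_sum, AddMemClass.coe_add,
    AddSubmonoidClass.coe_finsetSum, LinearMap.add_apply, LinearMap.sum_apply]
  have hterm : ∀ i ∈ Finset.range N',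
      (𝓨.mode (-r - 1) (M.Y (-1 - i) u (𝓩.mode (-s - 1 + i) w₁ w₂)) w₃).1 w₀
      = ∑ p ∈ Finset.range N, ((Ring.choose ((i + p : ℕ) : ℤ) i : ℤ) : ℂ) *
          (𝓨.mode (-(r - ((i + p : ℕ) : ℝ) + i) - 1) (𝓩.mode (-(s - i) - 1) w₁ w₂) w₃).1
            (M₀.adjointMode (-1 - ((i + p : ℕ) : ℤ)) u w₀)
        + ∑ p ∈ Finset.range N, ((Ring.choose (-1 - p : ℤ) i : ℤ) : ℂ) *
          (𝓨.mode (-(r - ((-1 - p : ℤ) : ℝ) + i) - 1) (𝓩.mode (-(s - i) - 1) w₁ w₂)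
            (M₃.Y p u w₃)).1 w₀ := by
    intro i _
    rw [𝓨.iterate_contragredient u w₀ _ w₃ (-1 - i) (-r - 1) (N := N) (N' := N) ?_ h₃,
      sub_eq_add_neg, ← Finset.sum_neg_distrib]
    · congr 1
      · refine Finset.sum_congr rfl fun p _ => ?_
        have hcoef : (-1 : ℂ) ^ p * ((Ring.choose (-1 - i : ℤ) p : ℤ) : ℂ)
            = ((Ring.choose ((i + p : ℕ) : ℤ) i : ℤ) : ℂ) := by
          rw [choose_neg_one_sub, Ring.choose_natCast, Nat.choose_symm_add]
          push_cast
          rw [← mul_assoc, ← mul_pow]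
          simp
        rw [hcoef, show (-1 - i : ℤ) - p = -1 - ((i + p : ℕ) : ℤ) by push_cast; ring,
          show -(r - ((i + p : ℕ) : ℝ) + i) - 1 = -r - 1 + p by push_cast; ring,
          show -s - 1 + (i : ℝ) = -(s - i) - 1 by ring]
      · refine Finset.sum_congr rfl fun p _ => ?_
        have hcoef : -((-1 : ℂ) ^ ((p : ℤ) + (-1 - i)) * ((Ring.choose (-1 - i : ℤ) p : ℤ) : ℂ))
            = ((Ring.choose (-1 - p : ℤ) i : ℤ) : ℂ) := by
          have h := congrArg (Int.cast : ℤ → ℂ) (choose_neg_one_sub_comm i p)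
          push_cast at h
          have h1 : ((-1 : ℂ) ^ i) * (-1) ^ i = 1 := by rw [← mul_pow]; simp
          have h2 : (-1 : ℂ) ^ ((p : ℤ) + (-1 - i)) = -((-1) ^ p * (-1) ^ i) := by
            rw [zpow_add₀ (by norm_num), zpow_sub₀ (by norm_num), zpow_natCast, zpow_natCast,
              ← inv_eq_of_mul_eq_one_left h1]
            norm_num
            exact eq_inv_of_mul_eq_one_left h1
          rw [h2]
          linear_combination ((-1 : ℂ) ^ i) * h
            + ((Ring.choose (-1 - p : ℤ) i : ℤ) : ℂ) * h1
        rw [← neg_mul, hcoef,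
          show -(r - ((-1 - p : ℤ) : ℝ) + i) - 1 = -r - 1 + ((-1 - i : ℤ) : ℝ) - p by
            push_cast; ring,
          show -s - 1 + (i : ℝ) = -(s - i) - 1 by ring]
    · intro p hp
      rw [show (-1 - i : ℤ) - p = -1 - ((i + p : ℕ) : ℤ) by push_cast; ring]
      exact h₀ _ (by omega)
  have hvanish : ∀ i : ℕ, N' ≤ i → 𝓩.mode (-(s - i) - 1) w₁ w₂ = 0 := by
    intro i hi
    rw [show -(s - (i : ℝ)) - 1 = -s - 1 + i by ring, hN' i hi]
  rw [Finset.sum_congr rfl hterm, Finset.sum_add_distrib, add_right_comm]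
  congr 1
  · congr 1
    -- With q = i + p the coefficient is (q choose i), and the missing terms q < i vanish: this is
    -- the expansion of (t + y)^q.
    · have hshift : ∀ i ∈ Finset.range N',
          ∑ p ∈ Finset.range N, ((Ring.choose ((i + p : ℕ) : ℤ) i : ℤ) : ℂ) *
          (𝓨.mode (-(r - ((i + p : ℕ) : ℝ) + i) - 1) (𝓩.mode (-(s - i) - 1) w₁ w₂) w₃).1
            (M₀.adjointMode (-1 - ((i + p : ℕ) : ℤ)) u w₀)
          = ∑ q ∈ Finset.range N, ((Ring.choose (q : ℤ) i : ℤ) : ℂ) *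
          (𝓨.mode (-(r - (q : ℝ) + i) - 1) (𝓩.mode (-(s - i) - 1) w₁ w₂) w₃).1
            (M₀.adjointMode (-1 - (q : ℤ)) u w₀) := by
        intro i _
        rw [← finsum_eq_sum_range (N := N), finsum_add_left_eq_sum_range (N := N)
          (f := fun q : ℕ => ((Ring.choose (q : ℤ) i : ℤ) : ℂ) *
            (𝓨.mode (-(r - (q : ℝ) + i) - 1) (𝓩.mode (-(s - i) - 1) w₁ w₂) w₃).1
              (M₀.adjointMode (-1 - (q : ℤ)) u w₀))]
        rotate_left 2
        · intro p hp
          rw [h₀ _ (show N ≤ i + p by omega), map_zero, mul_zero]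
        · intro q hq
          rw [Ring.choose_natCast, Nat.choose_eq_zero_of_lt hq]
          simp
        · intro q hq
          rw [h₀ _ hq, map_zero, mul_zero]
      rw [Finset.sum_congr rfl hshift, Finset.sum_comm]
      refine Finset.sum_congr rfl fun q _ => ?_
      rw [finsum_eq_sum_range (N := N')]
      · simp only [Int.cast_natCast]
      · intro i hi
        rw [hvanish i hi]
        simp
    · refine Finset.sum_congr rfl fun i _ => ?_
      rw [show -(s - ((-1 - i : ℤ) : ℝ)) - 1 = -s - 1 + ((-1 : ℤ) : ℝ) - i by push_cast; ring]
  · rw [Finset.sum_comm]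
    refine Finset.sum_congr rfl fun p _ => ?_
    rw [finsum_eq_sum_range (N := N')]
    intro i hi
    rw [hvanish i hi]
    simp

lemma iterateFunctional_pole₂ (u : V) (w₀ : W₀) (w₁ : W₁) (w₂ : W₂) (w₃ : W₃) (N : ℕ)
    (h₀ : ∀ i : ℕ, N ≤ i → M₀.adjointMode (-1 - i) u w₀ = 0)
    (h₁ : ∀ i : ℕ, N ≤ i → M₁.Y i u w₁ = 0) (h₃ : ∀ i : ℕ, N ≤ i → M₃.Y i u w₃ = 0) :
    iterateFunctional 𝓩 𝓨 w₀ w₁ (M₂.Y (-1) u w₂) w₃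
      = ∑ i ∈ Finset.range N, ((tUnit ^ (i : ℤ) : ExpansionRingˣ) : ExpansionRing) •
          iterateFunctional 𝓩 𝓨 (M₀.adjointMode (-1 - i) u w₀) w₁ w₂ w₃
        + ∑ i ∈ Finset.range N, (((-yUnit) ^ (-1 - i : ℤ) : ExpansionRingˣ) : ExpansionRing) •
          iterateFunctional 𝓩 𝓨 w₀ (M₁.Y i u w₁) w₂ w₃
        + ∑ i ∈ Finset.range N, ((tUnit ^ (-1 - i : ℤ) : ExpansionRingˣ) : ExpansionRing) •
          iterateFunctional 𝓩 𝓨 w₀ w₁ w₂ (M₃.Y i u w₃) := by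
  have hneg : ∀ (i : ℕ) (φ : boundedBelow),
      (((-yUnit) ^ (-1 - i : ℤ) : ExpansionRingˣ) : ExpansionRing) • φ
        = (-1 : ℤ) ^ (i + 1) • ((yUnit ^ (-1 - i : ℤ) : ExpansionRingˣ) : ExpansionRing) • φ :=
    fun i φ => neg_zpow_smul _ i φ
  ext r s
  simp only [hneg, add_boundedBelow_apply, sum_boundedBelow_apply, yUnit_zpow_smul_apply,
    tUnit_zpow_smul_apply, iterateFunctional_apply, zsmul_boundedBelow_apply]
  have h := 𝓨.iterate_contragredient u w₀ (𝓩.mode (-s - 1) w₁ w₂) w₃ (-1) (-r - 1) h₀ h₃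
  rw [𝓩.commutator u w₁ w₂ (-1) (-s - 1) h₁] at h
  simp only [neg_one_pow_mul_choose_neg_one, neg_one_zpow_mul_choose_neg_one, one_mul,
    neg_one_mul, Finset.sum_neg_distrib, sub_neg_eq_add, map_add, map_sum, map_smul,
    AddMemClass.coe_add, AddSubmonoidClass.coe_finsetSum, SetLike.val_smul, LinearMap.add_apply,
    LinearMap.sum_apply, LinearMap.smul_apply, smul_eq_mul] at h
  -- The commutator of u_{-1} with the inner operator contains the wanted term with u_{-1} w₂; the
  -- relation is solved for it.
  rw [← eq_sub_iff_add_eq] at h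
  rw [h, add_sub_right_comm, sub_eq_add_neg, ← Finset.sum_neg_distrib]
  congr 1
  · congr 1
    · refine Finset.sum_congr rfl fun i _ => ?_
      rw [show -r - 1 + (i : ℝ) = -(r - ((i : ℤ) : ℝ)) - 1 by push_cast; ring]
    · refine Finset.sum_congr rfl fun i _ => ?_
      have hcoef : ((Ring.choose (-1 : ℤ) i : ℤ) : ℂ) = (-1) ^ i := by
        have h1 : ((-1 : ℂ) ^ i) * (-1) ^ i = 1 := by rw [← mul_pow]; simp
        linear_combination ((-1) ^ i) * neg_one_pow_mul_choose_neg_one i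
          - ((Ring.choose (-1 : ℤ) i : ℤ) : ℂ) * h1
      rw [hcoef, show -(s - ((-1 - i : ℤ) : ℝ)) - 1 = -s - 1 + ((-1 : ℤ) : ℝ) - i by
        push_cast; ring]
      push_cast
      rw [pow_succ]
      ring
  · refine Finset.sum_congr rfl fun i _ => ?_
    rw [show -(r - ((-1 - i : ℤ) : ℝ)) - 1 = -r - 1 + ((-1 : ℤ) : ℝ) - i by push_cast; ring]

/-- Two commutator formulas yield products (m choose i)(i choose j); rewriting them as (m choose
j)(m-j choose i-j) exposes the expansion of (t + y)^(m-j). -/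
lemma iterateFunctional_pole_zero (m : ℤ) (u : V) (w₀ : W₀) (w₁ : W₁) (w₂ : W₂) (w₃ : W₃) (N : ℕ)
    (h₁ : ∀ i : ℕ, N ≤ i → M₁.Y i u w₁ = 0) (h₂ : ∀ i : ℕ, N ≤ i → M₂.Y i u w₂ = 0) :
    iterateFunctional 𝓩 𝓨 (M₀.adjointMode m u w₀) w₁ w₂ w₃
      = ∑ i ∈ Finset.range N,
          Ring.choose m i • ((tAddUnit 1 ^ (m - i : ℤ) : ExpansionRingˣ) : ExpansionRing) •
            iterateFunctional 𝓩 𝓨 w₀ (M₁.Y i u w₁) w₂ w₃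
        + ∑ i ∈ Finset.range N,
          Ring.choose m i • ((tUnit ^ (m - i : ℤ) : ExpansionRingˣ) : ExpansionRing) •
            iterateFunctional 𝓩 𝓨 w₀ w₁ (M₂.Y i u w₂) w₃
        + iterateFunctional 𝓩 𝓨 w₀ w₁ w₂ (M₃.Y m u w₃) := by
  ext r s
  simp only [add_boundedBelow_apply, sum_boundedBelow_apply, tUnit_zpow_smul_apply,
    tAddUnit_zpow_smul_apply, iterateFunctional_apply, zsmul_boundedBelow_apply, one_pow, mul_one]
  set v := 𝓩.mode (-s - 1) w₁ w₂ with hv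
  obtain ⟨N₁, hN₁⟩ := exists_nat_forall_eq_zero (M.truncation u v)
  have hev : ∀ᶠ n : ℕ in Filter.atTop, ∀ j ∈ Finset.range N, ∀ i : ℕ, n ≤ i →
      𝓩.mode (-s - 1 - j + i) (M₁.Y j u w₁) w₂ = 0 := by
    rw [Filter.eventually_all_finset]
    intro j _
    obtain ⟨n, hn⟩ := 𝓩.exists_mode_add_eq_zero (-s - 1 - j) (M₁.Y j u w₁) w₂
    filter_upwards [Filter.eventually_ge_atTop n] with n' hn' i hi using hn i (hn'.trans hi)
  obtain ⟨N', hN', hN'N, hN'N₁⟩ := (hev.and ((Filter.eventually_ge_atTop N).and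
    (Filter.eventually_ge_atTop N₁))).exists
  rw [𝓨.commutator_contragredient u w₀ v w₃ m (-r - 1) (N := N')
    (fun i hi => hN₁ i (hN'N₁.trans hi)), add_comm]
  congr 1
  have hterm : ∀ i ∈ Finset.range N', ((Ring.choose m i : ℤ) : ℂ) *
      (𝓨.mode (-r - 1 + (m : ℝ) - i) (M.Y i u v) w₃).1 w₀
      = ∑ j ∈ Finset.range N, ((Ring.choose m i : ℤ) : ℂ) * (((Ring.choose (i : ℤ) j : ℤ) : ℂ) *
          (𝓨.mode (-(r - (m - i)) - 1) (𝓩.mode (-(s - (i - j)) - 1) (M₁.Y j u w₁) w₂) w₃).1 w₀)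
        + ((Ring.choose m i : ℤ) : ℂ) *
          (𝓨.mode (-(r - ((m - i : ℤ) : ℝ)) - 1) (𝓩.mode (-s - 1) w₁ (M₂.Y i u w₂)) w₃).1 w₀ := by
    intro i _
    rw [hv, 𝓩.commutator u w₁ w₂ i (-s - 1) h₁]
    simp only [map_add, map_sum, map_smul, AddMemClass.coe_add, AddSubmonoidClass.coe_finsetSum,
      SetLike.val_smul, LinearMap.add_apply, LinearMap.sum_apply, LinearMap.smul_apply,
      smul_eq_mul]
    rw [show -(r - ((m : ℝ) - i)) - 1 = -r - 1 + (m : ℝ) - i by ring,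
      show -(r - ((m - i : ℤ) : ℝ)) - 1 = -r - 1 + (m : ℝ) - i by push_cast; ring, mul_add,
      add_comm, Finset.mul_sum]
    congr 1
    refine Finset.sum_congr rfl fun j _ => ?_
    rw [show -s - 1 + ((i : ℤ) : ℝ) - j = -(s - (i - j)) - 1 by push_cast; ring]
  rw [Finset.sum_congr rfl hterm, Finset.sum_add_distrib]
  congr 1
  · rw [Finset.sum_comm]
    refine Finset.sum_congr rfl fun j hj => ?_
    rw [← finsum_add_left_eq_sum_range (j := j), finsum_eq_sum_range (N := N'),
      finsum_eq_sum_range (N := N'), Finset.mul_sum]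
    · refine Finset.sum_congr rfl fun q _ => ?_
      have hcoef := congrArg (Int.cast : ℤ → ℂ) (choose_mul_choose_add m j q)
      push_cast at hcoef
      rw [← mul_assoc, ← mul_assoc,
        show -(r - ((m : ℝ) - ((j + q : ℕ) : ℝ))) - 1 = -(r - ((m - j : ℤ) : ℝ) + q) - 1 by
          push_cast; ring,
        show -(s - (((j + q : ℕ) : ℝ) - j)) - 1 = -(s - q) - 1 by push_cast; ring]
      push_cast
      rw [hcoef]
    · intro q hq
      rw [show -(s - (q : ℝ)) - 1 = -s - 1 - j + ((j + q : ℕ) : ℝ) by push_cast; ring,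
        hN' j hj _ (by omega)]
      simp
    · intro q hq
      rw [show -(s - (((j + q : ℕ) : ℝ) - j)) - 1 = -s - 1 - j + ((j + q : ℕ) : ℝ) by ring,
        hN' j hj _ (by omega)]
      simp
    · intro i hi
      rw [Ring.choose_natCast i j, Nat.choose_eq_zero_of_lt hi]
      simp
    · intro i hi
      rw [show -(s - ((i : ℝ) - j)) - 1 = -s - 1 - j + i by ring, hN' j hj i hi]
      simp
  · symm
    apply Finset.sum_subset (Finset.range_mono hN'N)
    intro i _ hi
    rw [h₂ i (by simpa using hi)]
    simp

theorem residueRelations_iterateFunctional :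
    ResidueRelations M₀ M₁ M₂ M₃ (tAddUnit 1) tUnit yUnit (iterateFunctional 𝓩 𝓨) where
  linear₀ _ _ _ := ⟨fun _ _ => by ext r s; simp [iterateFunctional, iterateSeries],
    fun _ _ => by ext r s; simp [iterateFunctional, iterateSeries]⟩
  linear₁ _ _ _ := ⟨fun _ _ => by ext r s; simp [iterateFunctional, iterateSeries],
    fun _ _ => by ext r s; simp [iterateFunctional, iterateSeries]⟩
  linear₂ _ _ _ := ⟨fun _ _ => by ext r s; simp [iterateFunctional, iterateSeries],
    fun _ _ => by ext r s; simp [iterateFunctional, iterateSeries]⟩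
  linear₃ _ _ _ := ⟨fun _ _ => by ext r s; simp [iterateFunctional, iterateSeries],
    fun _ _ => by ext r s; simp [iterateFunctional, iterateSeries]⟩
  pole₁ := iterateFunctional_pole₁ 𝓩 𝓨
  pole₂ := iterateFunctional_pole₂ 𝓩 𝓨
  pole_zero := iterateFunctional_pole_zero 𝓩 𝓨

lemma dy_iterateFunctional (w₀ : W₀) (w₁ : W₁) (w₂ : W₂) (w₃ : W₃) :
    dy (iterateFunctional 𝓩 𝓨 w₀ w₁ w₂ w₃).1
      = (iterateFunctional 𝓩 𝓨 w₀ (M₁.Y 0 𝕍.omega w₁) w₂ w₃).1 := by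
  funext r s
  rw [iterateFunctional_apply, 𝓩.derivative, dy, iterateFunctional_apply,
    show -(s + 1) - 1 = -s - 1 - 1 by ring]
  simp only [map_smul, SetLike.val_smul, LinearMap.smul_apply, smul_eq_mul]
  congr 1
  push_cast
  ring

/-- ∂/∂t applies L(-1) to the intermediate vector, where it acts as a derivation on 𝓩(w₁, y) w₂;
subtracting ∂/∂y removes the term with L(-1) w₁. -/
lemma dt_sub_dy_iterateFunctional (w₀ : W₀) (w₁ : W₁) (w₂ : W₂) (w₃ : W₃) :
    dt (iterateFunctional 𝓩 𝓨 w₀ w₁ w₂ w₃).1 - dy (iterateFunctional 𝓩 𝓨 w₀ w₁ w₂ w₃).1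
      = (iterateFunctional 𝓩 𝓨 w₀ w₁ (M₂.Y 0 𝕍.omega w₂) w₃).1 := by
  rw [dy_iterateFunctional, sub_eq_iff_eq_add]
  funext r s
  rw [Pi.add_apply, Pi.add_apply, iterateFunctional_apply, iterateFunctional_apply, dt,
    iterateFunctional_apply]
  have h := congrArg (fun f => f.1 w₀) (𝓨.derivative (-r - 1) (𝓩.mode (-s - 1) w₁ w₂) w₃)
  simp only [𝓩.commutator_zero, map_add, AddMemClass.coe_add, SetLike.val_smul,
    LinearMap.add_apply, LinearMap.smul_apply, smul_eq_mul] at h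
  rw [h, show -(r + 1) - 1 = -r - 1 - 1 by ring]
  congr 1
  push_cast
  ring

end Iterate

/-! ### The system of differential equations -/

section System

open TwoVariableSeries ExpansionRing

namespace CoeffRing

open MvPolynomial in
/-- The inclusion of the polynomial ring. -/
noncomputable abbrev ofPolynomial : MvPolynomial (Fin 2) ℂ →+* CoeffRing :=
  algebraMap (MvPolynomial (Fin 2) ℂ) CoeffRing

open MvPolynomial in
lemma isUnit_prod : IsUnit (ofPolynomial (X 0) * ofPolynomial (X 1) * ofPolynomial (X 0 - X 1)) := by
  rw [← map_mul, ← map_mul]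
  exact IsLocalization.Away.algebraMap_isUnit _

/-- `z₁` as a unit. -/
noncomputable def z₁ : CoeffRingˣ :=
  (isUnit_of_mul_isUnit_left (isUnit_of_mul_isUnit_left isUnit_prod)).unit

/-- `z₂` as a unit. -/
noncomputable def z₂ : CoeffRingˣ :=
  (isUnit_of_mul_isUnit_right (isUnit_of_mul_isUnit_left isUnit_prod)).unit

/-- `z₁ - z₂` as a unit. -/
noncomputable def d : CoeffRingˣ := (isUnit_of_mul_isUnit_right isUnit_prod).unit

variable {f₁ f₂ : ExpansionRing} (h : IsUnit (f₁ * f₂ * (f₁ - f₂)))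

lemma expand_ofPolynomial (p : MvPolynomial (Fin 2) ℂ) :
    expand f₁ f₂ h (ofPolynomial p)
      = MvPolynomial.eval₂ (HahnSeries.C.comp LaurentPolynomial.C) ![f₁, f₂] p :=
  IsLocalization.Away.lift_eq _ _ p

lemma expand_z₁ : expand f₁ f₂ h z₁ = f₁ :=
  (expand_ofPolynomial h _).trans (by simp)

lemma expand_z₂ : expand f₁ f₂ h z₂ = f₂ :=
  (expand_ofPolynomial h _).trans (by simp)

lemma expand_d : expand f₁ f₂ h d = f₁ - f₂ :=
  (expand_ofPolynomial h _).trans (by simp)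

lemma expand_algebraMap (c : ℂ) :
    expand f₁ f₂ h (algebraMap ℂ CoeffRing c) = HahnSeries.C (LaurentPolynomial.C c) := by
  rw [IsScalarTower.algebraMap_apply ℂ (MvPolynomial (Fin 2) ℂ) CoeffRing,
    expand_ofPolynomial, MvPolynomial.algebraMap_eq, MvPolynomial.eval₂_C]
  rfl

end CoeffRing

variable {V W₀ W₁ W₂ W₃ : Type*} [AddCommGroup V] [Module ℂ V]
  [AddCommGroup W₀] [Module ℂ W₀] [AddCommGroup W₁] [Module ℂ W₁]
  [AddCommGroup W₂] [Module ℂ W₂] [AddCommGroup W₃] [Module ℂ W₃]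
  {𝕍 : VertexOperatorAlgebra V}

lemma ResidueRelations.restrictScalars {M₀ : DiscreteModule 𝕍 W₀} {M₁ : DiscreteModule 𝕍 W₁}
    {M₂ : DiscreteModule 𝕍 W₂} {M₃ : DiscreteModule 𝕍 W₃} {R A S : Type*} [CommRing R] [CommRing A]
    [AddCommGroup S] [Module ℂ S] [Module A S] (ι : R →+* A) {z₁ z₂ d : Rˣ} {ζ₁ ζ₂ δ : Aˣ}
    (h₁ : ι z₁ = ζ₁) (h₂ : ι z₂ = ζ₂) (hd : ι d = δ) {F : W₀ → W₁ → W₂ → W₃ → S}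
    (h : ResidueRelations M₀ M₁ M₂ M₃ ζ₁ ζ₂ δ F) :
    letI := Module.compHom S ι
    ResidueRelations M₀ M₁ M₂ M₃ z₁ z₂ d F := by
  have e : ∀ {z : Rˣ} {ζ : Aˣ}, ι z = ζ → ∀ n : ℤ, ((ζ ^ n : Aˣ) : A) = ι ((z ^ n : Rˣ) : R) := by
    intro z ζ hz n
    have : ζ = Units.map ι.toMonoidHom z := Units.ext hz.symm
    rw [this, ← map_zpow]
    rfl
  have hd' : ι ((-d : Rˣ) : R) = ((-δ : Aˣ) : A) := by
    rw [Units.val_neg, Units.val_neg, map_neg, hd]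
  let _ := Module.compHom S ι
  refine ⟨h.linear₀, h.linear₁, h.linear₂, h.linear₃, ?_, ?_, ?_⟩
  · intro u w₀ w₁ w₂ w₃ N c₀ c₂ c₃
    have := h.pole₁ u w₀ w₁ w₂ w₃ N c₀ c₂ c₃
    simp only [e h₁, e hd] at this
    exact this
  · intro u w₀ w₁ w₂ w₃ N c₀ c₂ c₃
    have := h.pole₂ u w₀ w₁ w₂ w₃ N c₀ c₂ c₃
    simp only [e h₂, e hd'] at this
    exact this
  · intro m u w₀ w₁ w₂ w₃ N c₁ c₂
    have := h.pole_zero m u w₀ w₁ w₂ w₃ N c₁ c₂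
    simp only [e h₁, e h₂] at this
    exact this

/-- R is a localization of a polynomial ring, hence Noetherian. Each expansion makes the series an
R-module, and the relation found over R applies to all of these structures; this is why the three
regions share one system. -/
theorem exists_coefficients (M₀ : DiscreteModule 𝕍 W₀) (M₁ : DiscreteModule 𝕍 W₁)
    (M₂ : DiscreteModule 𝕍 W₂) (M₃ : DiscreteModule 𝕍 W₃)
    (h₀ : M₀.C₁Cofinite) (h₁ : M₁.C₁Cofinite) (h₂ : M₂.C₁Cofinite) (h₃ : M₃.C₁Cofinite)
    (w₀ : ℕ → W₀) (w₁ : ℕ → W₁) (w₂ : ℕ → W₂) (w₃ : ℕ → W₃) :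
    ∃ (m : ℕ) (a : ℕ → CoeffRing), 0 < m ∧
      ∀ (f₁ f₂ : ExpansionRing) (h : IsUnit (f₁ * f₂ * (f₁ - f₂))) (ζ₁ ζ₂ δ : ExpansionRingˣ)
        (F : W₀ → W₁ → W₂ → W₃ → boundedBelow), f₁ = ζ₁ → f₂ = ζ₂ → f₁ - f₂ = δ →
      ResidueRelations M₀ M₁ M₂ M₃ ζ₁ ζ₂ δ F →
      F (w₀ m) (w₁ m) (w₂ m) (w₃ m) + ∑ k ∈ Finset.Icc 1 m,
        expand f₁ f₂ h (a k) • F (w₀ (m - k)) (w₁ (m - k)) (w₂ (m - k)) (w₃ (m - k)) = 0 := by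
  have : IsNoetherianRing CoeffRing := IsLocalization.isNoetherianRing
    (Submonoid.powers (MvPolynomial.X 0 * MvPolynomial.X 1 *
      (MvPolynomial.X 0 - MvPolynomial.X 1) : MvPolynomial (Fin 2) ℂ)) _ inferInstance
  obtain ⟨m, a, hm, ha⟩ := exists_uniform_monic_relation M₀ M₁ M₂ M₃ CoeffRing.z₁ CoeffRing.z₂
    CoeffRing.d h₀ h₁ h₂ h₃ w₀ w₁ w₂ w₃
  refine ⟨m, a, hm, fun f₁ f₂ h ζ₁ ζ₂ δ F e₁ e₂ e₃ hF => ?_⟩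
  let _ : Module CoeffRing boundedBelow := Module.compHom boundedBelow (expand f₁ f₂ h)
  have : IsScalarTower ℂ CoeffRing boundedBelow := ⟨fun c r φ => by
    change expand f₁ f₂ h (c • r) • φ = c • expand f₁ f₂ h r • φ
    rw [Algebra.smul_def, map_mul, CoeffRing.expand_algebraMap, mul_smul, C_C_smul]⟩
  exact ha boundedBelow F (hF.restrictScalars (expand f₁ f₂ h)
    ((CoeffRing.expand_z₁ h).trans e₁) ((CoeffRing.expand_z₂ h).trans e₂)
    ((CoeffRing.expand_d h).trans e₃))

/-- The sequence `φ` consists of the successive derivatives of its first term, so a linear relation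
between its members is a differential equation. -/
lemma TwoVariableSeries.satisfiesODE_of_relation {D : TwoVariableSeries → TwoVariableSeries}
    {ι : CoeffRing →+* ExpansionRing} {m : ℕ} {a : ℕ → CoeffRing} (φ : ℕ → boundedBelow)
    (hD : ∀ k, D (φ k).1 = (φ (k + 1)).1)
    (h : φ m + ∑ k ∈ Finset.Icc 1 m, ι (a k) • φ (m - k) = 0) :
    (φ 0).1.SatisfiesODE ι D m a := by
  have hiter : ∀ k, D^[k] (φ 0).1 = (φ k).1 := by
    intro k
    induction k with
    | zero => rfl
    | succ k ih => rw [Function.iterate_succ_apply', ih, hD]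
  intro r s
  simp only [hiter]
  refine ⟨fun k _ => finite_support_mulTerm _ _ r s, ?_⟩
  have := congrArg (fun ψ : boundedBelow => ψ.1 r s) h
  simp only [add_boundedBelow_apply, sum_boundedBelow_apply, smul_apply] at this
  exact this

end System

theorem theorem1p4 {V W₀ W₁ W₂ W₃ : Type*} [AddCommGroup V] [Module ℂ V]
    [AddCommGroup W₀] [Module ℂ W₀] [AddCommGroup W₁] [Module ℂ W₁]
    [AddCommGroup W₂] [Module ℂ W₂] [AddCommGroup W₃] [Module ℂ W₃]
    (𝕍 : VertexOperatorAlgebra V)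
    (M₀ : DiscreteModule 𝕍 W₀) (M₁ : DiscreteModule 𝕍 W₁)
    (M₂ : DiscreteModule 𝕍 W₂) (M₃ : DiscreteModule 𝕍 W₃)
    (h₀ : M₀.C₁Cofinite) (h₁ : M₁.C₁Cofinite) (h₂ : M₂.C₁Cofinite) (h₃ : M₃.C₁Cofinite)
    (w₀ : W₀) (w₁ : W₁) (w₂ : W₂) (w₃ : W₃) :
    ∃ (m n : ℕ) (a b : ℕ → CoeffRing), 0 < m ∧ 0 < n ∧
      ∀ (W₄ W₅ W₆ : Type*) [AddCommGroup W₄] [Module ℂ W₄] [AddCommGroup W₅] [Module ℂ W₅]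
        [AddCommGroup W₆] [Module ℂ W₆]
        (M₄ : DiscreteModule 𝕍 W₄) (M₅ : DiscreteModule 𝕍 W₅) (M₆ : DiscreteModule 𝕍 W₆)
        (𝓨₁ : IntertwiningOperator 𝕍 M₁.Y M₄.Y M₀.contragredient)
        (𝓨₂ : IntertwiningOperator 𝕍 M₂.Y M₃.Y M₄.Y)
        (𝓨₃ : IntertwiningOperator 𝕍 M₁.Y M₂.Y M₅.Y)
        (𝓨₄ : IntertwiningOperator 𝕍 M₅.Y M₃.Y M₀.contragredient)
        (𝓨₅ : IntertwiningOperator 𝕍 M₂.Y M₆.Y M₀.contragredient)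
        (𝓨₆ : IntertwiningOperator 𝕍 M₁.Y M₃.Y M₆.Y),
        (productSeries 𝓨₁ 𝓨₂ w₀ w₁ w₂ w₃).SatisfiesProductSystem m n a b ∧
        (iterateSeries 𝓨₃ 𝓨₄ w₀ w₁ w₂ w₃).SatisfiesIterateSystem m n a b ∧
        (productSeries 𝓨₅ 𝓨₆ w₀ w₂ w₁ w₃).SatisfiesReversedSystem m n a b := by
  -- In each of the three series ∂/∂z₁ is L(-1) on `w₁`, and ∂/∂z₂ is L(-1) on `w₂`.
  obtain ⟨m, a, hm, ha⟩ := exists_coefficients M₀ M₁ M₂ M₃ h₀ h₁ h₂ h₃ (fun _ => w₀)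
    (fun k => (M₁.Y 0 𝕍.omega)^[k] w₁) (fun _ => w₂) (fun _ => w₃)
  obtain ⟨n, b, hn, hb⟩ := exists_coefficients M₀ M₁ M₂ M₃ h₀ h₁ h₂ h₃ (fun _ => w₀)
    (fun _ => w₁) (fun k => (M₂.Y 0 𝕍.omega)^[k] w₂) (fun _ => w₃)
  refine ⟨m, n, a, b, hm, hn, ?_⟩
  intro W₄ W₅ W₆ _ _ _ _ _ _ M₄ M₅ M₆ 𝓨₁ 𝓨₂ 𝓨₃ 𝓨₄ 𝓨₅ 𝓨₆
  have hsub : ExpansionRing.t - ExpansionRing.y = (ExpansionRing.tAddUnit (-1) : ExpansionRing) := by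
    change _ = ExpansionRing.t + HahnSeries.C (LaurentPolynomial.C (-1)) * ExpansionRing.y
    rw [map_neg, map_neg, map_one, map_one]
    ring
  have hsub' : ExpansionRing.y - ExpansionRing.t
      = ((-ExpansionRing.tAddUnit (-1) : ExpansionRingˣ) : ExpansionRing) := by
    rw [Units.val_neg, ← hsub, neg_sub]
  have hadd : ExpansionRing.t + ExpansionRing.y = (ExpansionRing.tAddUnit 1 : ExpansionRing) := by
    change _ = ExpansionRing.t + HahnSeries.C (LaurentPolynomial.C 1) * ExpansionRing.y
    rw [map_one, map_one, one_mul]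
  refine ⟨⟨?_, ?_⟩, ⟨?_, ?_⟩, ⟨?_, ?_⟩⟩
  · refine TwoVariableSeries.satisfiesODE_of_relation
      (fun k => productFunctional 𝓨₁ 𝓨₂ w₀ ((M₁.Y 0 𝕍.omega)^[k] w₁) w₂ w₃) (fun k => ?_)
      (ha _ _ _ _ _ _ (productFunctional 𝓨₁ 𝓨₂) rfl rfl hsub
        (residueRelations_productFunctional 𝓨₁ 𝓨₂))
    rw [dt_productFunctional, Function.iterate_succ_apply']
  · refine TwoVariableSeries.satisfiesODE_of_relation
      (fun k => productFunctional 𝓨₁ 𝓨₂ w₀ w₁ ((M₂.Y 0 𝕍.omega)^[k] w₂) w₃) (fun k => ?_)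
      (hb _ _ _ _ _ _ (productFunctional 𝓨₁ 𝓨₂) rfl rfl hsub
        (residueRelations_productFunctional 𝓨₁ 𝓨₂))
    rw [dy_productFunctional, Function.iterate_succ_apply']
  · refine TwoVariableSeries.satisfiesODE_of_relation
      (fun k => iterateFunctional 𝓨₃ 𝓨₄ w₀ ((M₁.Y 0 𝕍.omega)^[k] w₁) w₂ w₃) (fun k => ?_)
      (ha _ _ _ _ _ _ (iterateFunctional 𝓨₃ 𝓨₄) hadd rfl (add_sub_cancel_left _ _)
        (residueRelations_iterateFunctional 𝓨₃ 𝓨₄))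
    rw [dy_iterateFunctional, Function.iterate_succ_apply']
  · refine TwoVariableSeries.satisfiesODE_of_relation
      (fun k => iterateFunctional 𝓨₃ 𝓨₄ w₀ w₁ ((M₂.Y 0 𝕍.omega)^[k] w₂) w₃) (fun k => ?_)
      (hb _ _ _ _ _ _ (iterateFunctional 𝓨₃ 𝓨₄) hadd rfl (add_sub_cancel_left _ _)
        (residueRelations_iterateFunctional 𝓨₃ 𝓨₄))
    rw [dt_sub_dy_iterateFunctional, Function.iterate_succ_apply']
  -- The reversed product is a product with `w₁` and `w₂` interchanged, so here t = z₂, y = z₁ and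
  -- z₁ - z₂ = -(t - y).
  · refine TwoVariableSeries.satisfiesODE_of_relation
      (fun k => productFunctional 𝓨₅ 𝓨₆ w₀ w₂ ((M₁.Y 0 𝕍.omega)^[k] w₁) w₃) (fun k => ?_)
      (ha _ _ _ _ _ _ (fun v₀ v₁ v₂ v₃ => productFunctional 𝓨₅ 𝓨₆ v₀ v₂ v₁ v₃) rfl rfl hsub'
        (residueRelations_productFunctional 𝓨₅ 𝓨₆).swap)
    rw [dy_productFunctional, Function.iterate_succ_apply']
  · refine TwoVariableSeries.satisfiesODE_of_relation
      (fun k => productFunctional 𝓨₅ 𝓨₆ w₀ ((M₂.Y 0 𝕍.omega)^[k] w₂) w₁ w₃) (fun k => ?_)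
      (hb _ _ _ _ _ _ (fun v₀ v₁ v₂ v₃ => productFunctional 𝓨₅ 𝓨₆ v₀ v₂ v₁ v₃) rfl rfl hsub'
        (residueRelations_productFunctional 𝓨₅ 𝓨₆).swap)
    rw [dt_productFunctional, Function.iterate_succ_apply']
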